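/- Let $\epsilon\in(0,1)$, $\delta>0$ and $c\in\mathbb{R}$ be constants, let $\log=\log_2$, and put $\tau_n=\delta\,\log(1/\epsilon)\,(\log n)^{c-1}$. **Definitions.** Let $\mathbb{F}$ be a field and $M\in\mathbb{F}^{m\times n}$. An $(s,t)$-linear data structure for $M$ consists of linear maps $P:\mathbb{F}^n\to\mathbb{F}^{S}$ (preprocessing) with $S\le s$ and $Q:\mathbb{F}^{S}\to\mathbb{F}^m$ (queries) with $Q(P(x))=Mx$ for all $x\in\mathbb{F}^n$, such that each output coordinate of $Q$ depends on at most $t$ coordinates of its input. The row rigidity $RR_M(r)$ is the least $s\in\mathbb{N}$ such that the rank of $M$ can be brought down to at most $r$ by changing at most $s$ entries in every row. A family $(M_n)_{n\in\mathbb{N}}$ of matrices over a finite field is explicit if a deterministic algorithm outputs $M_n$ on input $1^n$ in time polynomial in $n$; it is computable in $\mathrm{P}^{\mathrm{NP}}$ if such an algorithm exists which may use an oracle for some language in NP. **Theorem.** There is $n_0=n_0(\epsilon,\delta,c)$ such that the following hold. 1. Let $\mathbb{F}$ be any field, $m\ge 0$, $n\ge n_0$ and $M\in\mathbb{F}^{m\times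 n}$. If $M$ has no $\left(\frac{n}{1-\epsilon},\,\delta(\log n)^c\right)$-linear data structure, then for some $n'\ge\tau_n$ there is an $m\times n'$ submatrix $M'$ of $M$ (formed by $n'$ of the columns of $M$) with $RR_{M'}(\epsilon n')\ge\tau_n$. In particular, for $\delta=1$ and $\epsilon\le\frac12$, if $M$ has no $\left(\frac{n}{1-\epsilon},(\log n)^c\right)$-linear data structure, then $RR_{M'}(\epsilon n')\ge(\log n)^{c-1}$ for such a submatrix with $n'\ge(\log n)^{c-1}$; for arbitrary $\epsilon\in(0,1)$ the same conclusion holds with $\delta=1/\log(1/\epsilon)$. 2. Suppose that the constant $\epsilon$ is such that $1^{\lfloor\epsilon n\rfloor}$ can be computed from $1^n$ in time polynomial in $n$ (as for every rational $\epsilon$). Let $\mathbb{F}$ be a finite field and let $(M_n)_{n\in\mathbb{N}}$, $M_n\in\mathbb{F}^{m(n)\times n}$, be an explicit family. Then there is a family $(M_n')_{n\in\mathbb{N}}$, computable in $\mathrm{P}^{\mathrm{NP}}$, in which $M_n'$ is an $m(n)\times n'(n)$ submatrix of $M_n$ formed by $n'(n)$ of its columns, such that for every $n\ge n_0$ for which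 $M_n$ has no $\left(\frac{n}{1-\epsilon},\,\delta(\log n)^c\right)$-linear data structure, $n'(n)\ge\tau_n$ and $RR_{M_n'}(\epsilon n'(n))\ge\tau_n$. -/

import Mathlib

/-! ### Linear data structures and row rigidity -/

namespace RigidityDS

/-- `M` has a linear data structure with space at most `s` and query time at most `t`:
a linear preprocessing map `P` stores a database `x ∈ F^n` into `S ≤ s` cells, a linear map `Q`
answers the `m` queries `x ↦ (M x)_i`, and the answer to every query depends
only on a set of at most `t` cells, which does not depend on the database. -/
def HasLinearDataStructure {F : Type*} [Field F] {m n : ℕ} (M : Matrix (Fin m) (Fin n) F)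
    (s t : ℝ) : Prop :=
  ∃ (S : ℕ) (P : (Fin n → F) →ₗ[F] (Fin S → F)) (Q : (Fin S → F) →ₗ[F] (Fin m → F)),
    (S : ℝ) ≤ s ∧
    (∀ i : Fin m, ∃ J : Finset (Fin S), (J.card : ℝ) ≤ t ∧
      ∀ y y' : Fin S → F, (∀ j ∈ J, y j = y' j) → Q y i = Q y' i) ∧
    ∀ x : Fin n → F, Q (P x) = M.mulVec x

/-- A matrix is `t`-row sparse if each of its rows has at most `t` non-zero entries. -/
def RowSparse {F : Type*} [Field F] {m n : ℕ} (A : Matrix (Fin m) (Fin n) F) (t : ℕ) : Prop :=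
  ∀ i : Fin m, {j : Fin n | A i j ≠ 0}.ncard ≤ t

/-- Row rigidity of `M` for rank `r`: the least `t` such that changing at most `t` entries in
every row can bring the rank down to at most `r`. (For `r ≥ 0` such `t` exist.) -/
noncomputable def rowRigidity {F : Type*} [Field F] {m n : ℕ} (M : Matrix (Fin m) (Fin n) F)
    (r : ℝ) : ℕ :=
  sInf {t : ℕ | ∃ A : Matrix (Fin m) (Fin n) F, RowSparse A t ∧ ((M + A).rank : ℝ) ≤ r}

/-! ### Random access machines with an oracle

A program works on finitely many named arrays of natural numbers. Constants, reading a cell,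
addition, truncated subtraction and writing a cell are the operations, each elementary command
costs one step, and a query to the oracle costs one step more than the length of the queried
word. There is no multiplication, so that this model is polynomially equivalent to
(oracle) Turing machines. -/

/-- The memory: `σ a i` is the content of cell `i` of array `a`. -/
abbrev Store : Type := ℕ → ℕ → ℕ

/-- Arithmetic expressions; `get a i` reads cell `i` of the array `a`. -/
inductive Expr : Type
  | lit (k : ℕ) : Expr
  | get (a : ℕ) (i : Expr) : Expr
  | add (x y : Expr) : Expr
  | sub (x y : Expr) : Expr

/-- The value of an expression. -/
def Expr.eval (σ : Store) : Expr → ℕ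
  | .lit k => k
  | .get a i => σ a (i.eval σ)
  | .add x y => x.eval σ + y.eval σ
  | .sub x y => x.eval σ - y.eval σ

/-- Write the value `v` into cell `i` of array `a`. -/
def Store.write (σ : Store) (a i v : ℕ) : Store :=
  fun a' i' => if a' = a ∧ i' = i then v else σ a' i'

/-- The binary word kept in array `a`: cell `0` holds its length, cell `i + 1` its `i`-th bit
(a non-zero cell stands for `true`). -/
def Store.word (σ : Store) (a : ℕ) : List Bool :=
  (List.range (σ a 0)).map fun i => decide (σ a (i + 1) ≠ 0)

/-- The initial memory on the input words `ws`: the `a`-th word is in array `a`, everything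
else is zero. -/
def initStore (ws : List (List Bool)) : Store := fun a i =>
  match i with
  | 0 => (ws.getD a []).length
  | i + 1 => if (ws.getD a []).getD i false = true then 1 else 0

/-- Programs. -/
inductive Cmd : Type
  | skip : Cmd
  /-- write the value of `e` into the cell of array `a` whose index is the value of `i` -/
  | assign (a : ℕ) (i e : Expr) : Cmd
  | seq (c d : Cmd) : Cmd
  /-- run `c` if the value of `e` is non-zero, and `d` otherwise -/
  | ite (e : Expr) (c d : Cmd) : Cmd
  /-- run `c` as long as the value of `e` is non-zero -/
  | loop (e : Expr) (c : Cmd) : Cmd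
  /-- ask the oracle about the word in array `a`, write the answer (`1` or `0`) into cell `0`
  of array `b` -/
  | query (a b : ℕ) : Cmd

/-- `Exec O c σ k τ`: with the oracle `O`, the program `c` started on the memory `σ` halts after
exactly `k` steps with the memory `τ`. -/
inductive Exec (O : Set (List Bool)) : Cmd → Store → ℕ → Store → Prop
  | skip (σ : Store) : Exec O .skip σ 1 σ
  | assign (a : ℕ) (i e : Expr) (σ : Store) :
      Exec O (.assign a i e) σ 1 (σ.write a (i.eval σ) (e.eval σ))
  | seq {c d : Cmd} {σ τ υ : Store} {k l : ℕ} (h₁ : Exec O c σ k τ) (h₂ : Exec O d τ l υ) :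
      Exec O (.seq c d) σ (k + l) υ
  | ite_true {e : Expr} {c d : Cmd} {σ τ : Store} {k : ℕ} (h : e.eval σ ≠ 0)
      (h₁ : Exec O c σ k τ) : Exec O (.ite e c d) σ (k + 1) τ
  | ite_false {e : Expr} {c d : Cmd} {σ τ : Store} {k : ℕ} (h : e.eval σ = 0)
      (h₁ : Exec O d σ k τ) : Exec O (.ite e c d) σ (k + 1) τ
  | loop_step {e : Expr} {c : Cmd} {σ τ υ : Store} {k l : ℕ} (h : e.eval σ ≠ 0)
      (h₁ : Exec O c σ k τ) (h₂ : Exec O (.loop e c) τ l υ) :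
      Exec O (.loop e c) σ (k + l + 1) υ
  | loop_done {e : Expr} {c : Cmd} {σ : Store} (h : e.eval σ = 0) : Exec O (.loop e c) σ 1 σ
  | query_yes (a b : ℕ) (σ : Store) (h : σ.word a ∈ O) :
      Exec O (.query a b) σ ((σ.word a).length + 1) (σ.write b 0 1)
  | query_no (a b : ℕ) (σ : Store) (h : σ.word a ∉ O) :
      Exec O (.query a b) σ ((σ.word a).length + 1) (σ.write b 0 0)

/-- The map sending the input words `inp x` to the word `out x` is computed by one program with
oracle `O` in time polynomial in the total length of the input words. The output is read
off array `0`, and its length counts towards the running time. -/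
def PolyTime (O : Set (List Bool)) {ι : Type} (inp : ι → List (List Bool))
    (out : ι → List Bool) : Prop :=
  ∃ (c : Cmd) (p : Polynomial ℕ), ∀ x : ι, ∃ (k : ℕ) (τ : Store),
    Exec O c (initStore (inp x)) k τ ∧ τ.word 0 = out x ∧
      k + (out x).length ≤ p.eval ((inp x).map List.length).sum

/-- The class NP: membership has witnesses of polynomial length that are verified in
deterministic polynomial time (without oracle, that is, with the empty oracle). -/
def InNP (L : Set (List Bool)) : Prop :=
  ∃ (V : List Bool × List Bool → Bool) (p : Polynomial ℕ),
    PolyTime ∅ (fun z : List Bool × List Bool => [z.1, z.2]) (fun z => [V z]) ∧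
    ∀ x : List Bool, x ∈ L ↔ ∃ y : List Bool, y.length ≤ p.eval x.length ∧ V (x, y) = true

/-- `f n` is computed from `n`, given in unary, in time polynomial in `n` with oracle `O`. -/
def PolyTimeUnary (O : Set (List Bool)) (f : ℕ → List Bool) : Prop :=
  PolyTime O (fun n : ℕ => [List.replicate n true]) f

/-! ### Matrices as words, explicit families, and families computable in `P^NP` -/

/-- A list of natural numbers as a binary word: each number in unary, closed by a `false`. -/
def encodeNats (l : List ℕ) : List Bool :=
  l.flatMap fun k => List.replicate k true ++ [false]

/-- A matrix over a finite field as a binary word: the number of rows, the number of columns, and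
the entries row by row, where `e` enumerates the elements of the field. -/
def encodeMatrix {F : Type*} {q : ℕ} (e : F ≃ Fin q) {m n : ℕ}
    (M : Matrix (Fin m) (Fin n) F) : List Bool :=
  encodeNats (m :: n ::
    (List.finRange m).flatMap fun i => (List.finRange n).map fun j => (e (M i j) : ℕ))

/-- The family `M` is explicit: a deterministic algorithm outputs `M n` on input `n` (in unary)
in time polynomial in `n`. -/
def Explicit {F : Type*} {q : ℕ} (e : F ≃ Fin q) {m n : ℕ → ℕ}
    (M : ∀ k : ℕ, Matrix (Fin (m k)) (Fin (n k)) F) : Prop :=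
  PolyTimeUnary ∅ fun k => encodeMatrix e (M k)

/-- The family `M` is computable in `P^NP`: a deterministic algorithm with an oracle for some
language in NP outputs `M n` on input `n` (in unary) in time polynomial in `n`. -/
def ComputableInPNP {F : Type*} {q : ℕ} (e : F ≃ Fin q) {m n : ℕ → ℕ}
    (M : ∀ k : ℕ, Matrix (Fin (m k)) (Fin (n k)) F) : Prop :=
  ∃ L : Set (List Bool), InNP L ∧ PolyTimeUnary L fun k => encodeMatrix e (M k)

end RigidityDS

namespace RigidityDS

/-! ### Column reductions and row rigidity -/

open scoped Matrix

/-! Let `s` be the integer with `s < τ ≤ s + 1`, so that being at least `τ` means exceeding `s` for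
a natural number. Suppose the submatrix on a column set `J` with more than `s` elements has row
rigidity at most `s` for rank `ε|J|`. Changing at most `s` entries per row gives a matrix `L` whose
columns are combinations, with coefficients `C`, of those in some `J' ⊆ J` with `|J'| ≤ ε|J|`. With
`D = M - L` this reads `M_J = D(1 - C) + M_{J'} C`. The sparse factor `D` costs `|J|` cells and `s`
probes, and what is left is again a column submatrix of `M`, so the step can be repeated
(`HasCells.of_columnReduction`). If at most `s` columns are ever left, they are stored directly. The
cells add up to at most `n/(1-ε)` by the geometric series, and about `log(n/τ)/log(1/ε)` rounds of
`s` probes fit into `δ(log n)^c` for large `n` (`hasCells_of_chain`, `exists_threshold`). Without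
such a data structure the process stops at a set of more than `s` columns that admits no reduction,
and this set is rigid (`lt_rowRigidity_of_not_columnReduction`). This is part 1.

For part 2 the same process is run with an oracle. Whether a reduction exists that agrees with the
decisions so far and drops the next column is an NP question, so one reduction is found column by
column (`greedy_spec`). Every query is the code of the matrix followed by all earlier answers, so
the search amounts to iterating `answerStep`; the language does not depend on the family
(`correctAnswers`). The number `τ` need not be computable: all `s` below the code length are tried,
and the largest one whose final set has more than `s` columns is kept. It is at least the `s`
belonging to `τ`, because that one succeeds when there is no data structure
(`CorrectAnswers.rigid`).

The complexity claims rest on a small language of terms with bounded sums. Each term compiles to a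
polynomial-time program (`Tm.runs_compile`), and the witness check (`witness_uniform`) and the
output (`selectedPosition_uniform`, `selectedValue_uniform`) are defined by terms. -/

/-- The columns `J` of `M` can be changed, in at most `s` entries of every row, so that they become
linear combinations of the at most `r` changed columns in `J'`. -/
def ColumnReduction {F : Type*} [Field F] {m n : ℕ} (M : Matrix (Fin m) (Fin n) F) (s r : ℕ)
    (J J' : Finset (Fin n)) : Prop :=
  J' ⊆ J ∧ J'.card ≤ r ∧ ∃ (L : Matrix (Fin m) (Fin n) F) (C : Matrix (Fin n) (Fin n) F),
    (∀ i, {j | j ∈ J ∧ L i j ≠ M i j}.ncard ≤ s) ∧ ∀ i, ∀ j ∈ J, L i j = ∑ a ∈ J', L i a * C a j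

/-- A basis of the column space can be chosen among the columns themselves. That it is indexed by
columns is what lets the recursion return to a submatrix of `M`. -/
theorem exists_spanning_columns {F : Type*} [Field F] {m n : ℕ} (L : Matrix (Fin m) (Fin n) F) :
    ∃ I : Finset (Fin n), I.card = L.rank ∧
      ∃ C : Matrix (Fin n) (Fin n) F, ∀ i j, L i j = ∑ a ∈ I, L i a * C a j := by
  classical
  obtain ⟨κ, a, ha, hs, hl⟩ := exists_linearIndependent' F L.col
  have : Finite κ := Finite.of_injective a ha
  have := Fintype.ofFinite κ
  refine ⟨Finset.univ.image a, ?_, ?_⟩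
  · rw [Finset.card_image_of_injective _ ha, Matrix.rank_eq_finrank_span_cols, ← hs,
      finrank_span_eq_card hl, Finset.card_univ]
  · have h : ∀ j, ∃ c : κ → F, ∑ k, c k • (L.col ∘ a) k = L.col j := fun j => by
      have : L.col j ∈ Submodule.span F (Set.range (L.col ∘ a)) := by
        rw [hs]; exact Submodule.subset_span ⟨j, rfl⟩
      exact (Submodule.mem_span_range_iff_exists_fun F).1 this
    choose c hc using h
    refine ⟨fun x j => Function.extend a (c j) 0 x, fun i j => ?_⟩
    rw [Finset.sum_image (fun x _ y _ h => ha h)]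
    have := congrFun (hc j) i
    simp only [Finset.sum_apply, Pi.smul_apply, smul_eq_mul, Function.comp, Matrix.col_apply] at this
    rw [← this]
    refine Finset.sum_congr rfl fun k _ => ?_
    change _ = L i (a k) * Function.extend a (c j) 0 (a k)
    rw [ha.extend_apply, mul_comm]

/-- If few changes lowered the rank, a column basis of the changed submatrix would be a reduction.
Changes and coefficients are carried back to all `n` columns by extension with zero along the
enumeration of `J`. -/
theorem lt_rowRigidity_of_not_columnReduction {F : Type*} [Field F] {m n : ℕ}
    (M : Matrix (Fin m) (Fin n) F) {ε : ℝ} (hε : 0 ≤ ε) (s : ℕ) (J : Finset (Fin n))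
    (h : ¬ ∃ J', ColumnReduction M s ⌊ε * J.card⌋₊ J J') :
    s < rowRigidity (M.submatrix id (J.orderEmbOfFin rfl)) (ε * J.card) := by
  classical
  by_contra hlt
  push Not at hlt
  apply h
  set f := J.orderEmbOfFin rfl with hf
  have hmem : rowRigidity (M.submatrix id f) (ε * J.card) ∈ {t : ℕ | ∃ A : Matrix (Fin m)
      (Fin J.card) F, RowSparse A t ∧ ((M.submatrix id f + A).rank : ℝ) ≤ ε * J.card} := by
    -- The infimum is attained, since changing every entry to zero is always possible.
    apply Nat.sInf_mem
    refine ⟨J.card, -M.submatrix id f, fun i => ?_, ?_⟩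
    · exact (Set.ncard_le_card _).trans (by simp)
    · simp only [add_neg_cancel, Matrix.rank_zero, Nat.cast_zero]; positivity
  obtain ⟨A, hA, hr⟩ := hmem
  obtain ⟨I, hI, C, hC⟩ := exists_spanning_columns (M.submatrix id f + A)
  have hfi : Function.Injective f := f.injective
  refine ⟨I.map f.toEmbedding, ?_, ?_, fun i j => M i j + Function.extend f (A i) 0 j,
    fun a j => Function.extend f (fun a' => Function.extend f (C a') 0 j) 0 a, ?_, ?_⟩
  · intro x hx
    obtain ⟨y, -, rfl⟩ := Finset.mem_map.1 hx
    exact Finset.orderEmbOfFin_mem J rfl y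
  · rw [Finset.card_map, hI]
    exact Nat.le_floor hr
  · intro i
    refine le_trans ?_ ((hA i).trans hlt)
    rw [← Set.ncard_image_of_injective _ hfi]
    refine Set.ncard_le_ncard ?_ (Set.toFinite _)
    rintro j ⟨hj, hne⟩
    have : j ∈ Set.range f := by rw [hf, Finset.range_orderEmbOfFin]; exact hj
    obtain ⟨k, rfl⟩ := this
    refine ⟨k, ?_, rfl⟩
    simpa [hfi.extend_apply] using hne
  · intro i j hj
    have : j ∈ Set.range f := by rw [hf, Finset.range_orderEmbOfFin]; exact hj
    obtain ⟨k, rfl⟩ := this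
    have := hC i k
    simp only [Matrix.add_apply, Matrix.submatrix_apply, id] at this
    simp [hfi.extend_apply, this]

/-! ### Data structures from iterated column reductions -/

/-- The columns `J` of `M` have a factorisation through `S` cells in which each row of the left
factor has at most `t` non-zero entries. -/
def HasCells {F : Type*} [Field F] {m n : ℕ} (M : Matrix (Fin m) (Fin n) F) (J : Finset (Fin n))
    (S t : ℕ) : Prop :=
  ∃ (κ : Type) (_ : Fintype κ) (Q : Matrix (Fin m) κ F) (P : Matrix κ (Fin n) F),
    Fintype.card κ ≤ S ∧ (∀ i, {k | Q i k ≠ 0}.ncard ≤ t) ∧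
    ∀ i j, (Q * P) i j = if j ∈ J then M i j else 0

theorem HasCells.hasLinearDataStructure {F : Type*} [Field F] {m n : ℕ}
    {M : Matrix (Fin m) (Fin n) F} {S t : ℕ} (h : HasCells M Finset.univ S t) {s' t' : ℝ}
    (hs : (S : ℝ) ≤ s') (ht : (t : ℝ) ≤ t') : HasLinearDataStructure M s' t' := by
  classical
  obtain ⟨κ, _, Q, P, hS, hQ, hM⟩ := h
  let f := Fintype.equivFin κ
  have hQP : Q * P = M := by ext i j; simp [hM]
  refine ⟨Fintype.card κ, (P.submatrix f.symm id).mulVecLin, (Q.submatrix id f.symm).mulVecLin,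
    le_trans (by exact_mod_cast hS) hs, fun i => ?_, fun x => ?_⟩
  · refine ⟨(Set.toFinite {k | Q i (f.symm k) ≠ 0}).toFinset, ?_, fun y y' hy => ?_⟩
    · refine le_trans ?_ ht
      rw [← Set.ncard_eq_toFinset_card]
      refine Nat.cast_le.2 (le_trans ?_ (hQ i))
      rw [← Set.ncard_image_of_injective _ f.symm.injective]
      refine Set.ncard_le_ncard ?_ (Set.toFinite _)
      rintro _ ⟨k, hk, rfl⟩
      exact hk
    · simp only [Matrix.mulVecLin_apply, Matrix.mulVec, dotProduct, Matrix.submatrix_apply, id]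
      refine Finset.sum_congr rfl fun k _ => ?_
      by_cases hk : Q i (f.symm k) = 0
      · simp [hk]
      · rw [hy k (by simpa using hk)]
  · simp only [Matrix.mulVecLin_apply, Matrix.mulVec_mulVec]
    have h2 := Matrix.submatrix_mul_equiv Q P (id : Fin m → Fin m) f.symm (id : Fin n → Fin n)
    rw [h2, hQP, Matrix.submatrix_id_id]

theorem hasCells_self {F : Type*} [Field F] {m n : ℕ} (M : Matrix (Fin m) (Fin n) F)
    (J : Finset (Fin n)) : HasCells M J J.card J.card := by
  classical
  refine ⟨{j // j ∈ J}, inferInstance, fun i k => M i k, fun k j => if (k : Fin n) = j then 1 else 0,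
    by simp, fun i => (Set.ncard_le_card _).trans (by simp), fun i j => ?_⟩
  change (∑ k : {j // j ∈ J}, M i k * if (k : Fin n) = j then 1 else 0) = _
  simp only [mul_ite, mul_one, mul_zero]
  split_ifs with h
  · rw [Finset.sum_eq_single ⟨j, h⟩] <;> aesop
  · refine Finset.sum_eq_zero fun k _ => if_neg ?_
    rintro rfl
    exact h k.2

/-- With `D = M - L`, the identity `M_J = D(1 - C) + M_{J'} C` holds on `J` because `L_J = L_{J'}
C`. The new cells hold `(1 - C)x` and are read through the sparse `D`; the old cells are filled from
`C x` instead of `x`. -/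
theorem HasCells.of_columnReduction {F : Type*} [Field F] {m n : ℕ}
    {M : Matrix (Fin m) (Fin n) F} {J J' : Finset (Fin n)} {s r S t : ℕ}
    (hJ : ColumnReduction M s r J J') (h : HasCells M J' S t) :
    HasCells M J (J.card + S) (s + t) := by
  classical
  obtain ⟨hsub, -, L, C, hL, hC⟩ := hJ
  obtain ⟨κ, _, Q, P, hS, hQ, hM⟩ := h
  let D : Matrix (Fin m) {j // j ∈ J} F := fun i k => M i k - L i k
  let E : Matrix {j // j ∈ J} (Fin n) F := fun k j =>
    (if (k : Fin n) = j then 1 else 0) - if (k : Fin n) ∈ J' ∧ j ∈ J then C k j else 0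
  -- Truncated so that the product vanishes on columns outside `J`.
  let C' : Matrix (Fin n) (Fin n) F := fun a j => if j ∈ J then C a j else 0
  refine ⟨{j // j ∈ J} ⊕ κ, inferInstance, Matrix.fromCols D Q, Matrix.fromRows E (P * C'), ?_,
    fun i => ?_, fun i j => ?_⟩
  · simpa using hS
  · have h1 : {k | Matrix.fromCols D Q i k ≠ 0} ⊆
        Sum.inl '' {k | D i k ≠ 0} ∪ Sum.inr '' {k | Q i k ≠ 0} := by
      rintro (k | k) hk
      · exact Or.inl ⟨k, hk, rfl⟩
      · exact Or.inr ⟨k, hk, rfl⟩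
    refine (Set.ncard_le_ncard h1 (Set.toFinite _)).trans ((Set.ncard_union_le _ _).trans ?_)
    rw [Set.ncard_image_of_injective _ Sum.inl_injective,
      Set.ncard_image_of_injective _ Sum.inr_injective]
    refine add_le_add (le_trans ?_ (hL i)) (hQ i)
    rw [← Set.ncard_image_of_injective _ Subtype.val_injective]
    refine Set.ncard_le_ncard ?_ (Set.toFinite _)
    rintro _ ⟨k, hk, rfl⟩
    refine ⟨k.2, fun h => hk ?_⟩
    simp [D, h]
  · rw [Matrix.fromCols_mul_fromRows, Matrix.add_apply, ← Matrix.mul_assoc]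
    have h1 : ((Q * P) * C') i j = if j ∈ J then ∑ a ∈ J', M i a * C a j else 0 := by
      rw [Matrix.mul_apply]
      simp only [hM, C', ite_mul, zero_mul, mul_ite, mul_zero]
      split_ifs <;> simp [Finset.sum_ite_mem]
    have h2 : (D * E) i j = if j ∈ J then (M i j - L i j) - ∑ a ∈ J', (M i a - L i a) * C a j
        else 0 := by
      rw [Matrix.mul_apply]
      simp only [D, E, mul_sub, Finset.sum_sub_distrib, mul_ite, mul_one, mul_zero]
      rw [Finset.sum_coe_sort J (fun k => if k = j then M i k - L i k else 0),
        Finset.sum_coe_sort J (fun k => if k ∈ J' ∧ j ∈ J then (M i k - L i k) * C k j else 0)]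
      split_ifs with h
      · simp only [h, and_true, Finset.sum_ite_mem, Finset.sum_ite_eq', if_true,
          Finset.inter_eq_right.2 hsub]
      · simp [h]
    rw [h1, h2]
    split_ifs with h
    · simp only [sub_mul, Finset.sum_sub_distrib]
      rw [← hC i j h]; ring
    · simp

/-- Induction from the end of the chain, cut off as soon as at most `s` columns are present. A round
adds `|I|` cells and leaves at most `ε|I|` columns, so the bound `|I|/(1-ε)` reproduces itself. It
also lowers `log(|I|/τ)/log(1/ε)` by at least one, which pays for its `s` probes. The alternative `t
≤ s` covers the sets stored directly, which may be smaller than `τ` and make this logarithm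
negative. -/
theorem hasCells_of_chain {F : Type*} [Field F] {m n : ℕ} (M : Matrix (Fin m) (Fin n) F)
    {ε τ : ℝ} (hε₀ : 0 < ε) (hε₁ : ε < 1) {s : ℕ} (hs : (s : ℝ) < τ) (hτ : τ ≤ s + 1)
    {J Jf : Finset (Fin n)} (hf : Jf.card ≤ s)
    (h : Relation.ReflTransGen (fun I I' => ColumnReduction M s ⌊ε * I.card⌋₊ I I') J Jf) :
    ∃ S t : ℕ, HasCells M J S t ∧ (S : ℝ) ≤ J.card / (1 - ε) ∧
      (t ≤ s ∨ (τ ≤ J.card ∧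
        (t : ℝ) ≤ s * (2 + Real.logb 2 (J.card / τ) / Real.logb 2 (1 / ε)))) := by
  have hτ0 : 0 < τ := lt_of_le_of_lt (Nat.cast_nonneg s) hs
  have hε' : 0 < 1 - ε := by linarith
  have hlog : 0 < Real.logb 2 (1 / ε) :=
    Real.logb_pos (by norm_num) (by rw [lt_div_iff₀ hε₀]; linarith)
  have base : ∀ I : Finset (Fin n), I.card ≤ s → ∃ S t : ℕ, HasCells M I S t ∧
      (S : ℝ) ≤ I.card / (1 - ε) ∧ (t ≤ s ∨ (τ ≤ I.card ∧
        (t : ℝ) ≤ s * (2 + Real.logb 2 (I.card / τ) / Real.logb 2 (1 / ε)))) := fun I hI =>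
    ⟨_, _, hasCells_self M I, by
      rw [le_div_iff₀ hε']; nlinarith [Nat.cast_nonneg (α := ℝ) I.card], Or.inl hI⟩
  induction h using Relation.ReflTransGen.head_induction_on with
  | refl => exact base _ hf
  | @head I I' hII' _ ih =>
    by_cases hI : I.card ≤ s
    · exact base _ hI
    obtain ⟨S, t, hc, hS, ht⟩ := ih
    have hτI : τ ≤ I.card := hτ.trans (by exact_mod_cast Nat.lt_of_not_le hI)
    have hcard : (I'.card : ℝ) ≤ ε * I.card := by
      have := hII'.2.1
      exact (Nat.cast_le.2 this).trans (Nat.floor_le (by positivity))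
    have hIpos : (0 : ℝ) < I.card := hτ0.trans_le hτI
    refine ⟨_, _, hc.of_columnReduction hII', ?_, Or.inr ⟨hτI, ?_⟩⟩
    · rw [le_div_iff₀ hε'] at hS ⊢
      push_cast
      nlinarith
    · have hs0 : (0 : ℝ) ≤ s := Nat.cast_nonneg s
      push_cast
      -- After a directly stored set the total is at most `2s`; this is the origin of the constant
      -- 2.
      rcases ht with ht | ⟨hτ', ht⟩
      · have : 0 ≤ Real.logb 2 (I.card / τ) / Real.logb 2 (1 / ε) :=
          div_nonneg (Real.logb_nonneg (by norm_num) (by rwa [le_div_iff₀ hτ0, one_mul])) hlog.le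
        have ht' : (t : ℝ) ≤ s := by exact_mod_cast ht
        nlinarith
      · have h1 : Real.logb 2 (I'.card / τ) ≤
            Real.logb 2 (I.card / τ) - Real.logb 2 (1 / ε) := by
          have hI' : (0 : ℝ) < I'.card := hτ0.trans_le hτ'
          rw [← Real.logb_div (by positivity) (by positivity)]
          refine Real.logb_le_logb_of_le (by norm_num) (by positivity) ?_
          rw [div_div_eq_mul_div, div_one, div_mul_eq_mul_div]
          gcongr
          linarith
        have h2 : Real.logb 2 (I'.card / τ) / Real.logb 2 (1 / ε) ≤
            Real.logb 2 (I.card / τ) / Real.logb 2 (1 / ε) - 1 := by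
          rw [div_le_iff₀ hlog, sub_mul, one_mul, div_mul_cancel₀ _ hlog.ne']
          exact h1
        nlinarith

/-- With `x = log n` and `l = log(1/ε)`, the target `δx^c` equals `τx/l`, to be compared with `s(2 +
(x - log τ)/l)`. For `c < 1`, `τ` tends to 0 and `s = 0` works. For `c = 1`, `τ` is constant and the
strict inequality `s < τ` leaves slack linear in `x`. For `c > 1`, `τ` tends to infinity, so `log τ`
eventually absorbs the 2. -/
theorem exists_threshold (ε δ c : ℝ) (hε₀ : 0 < ε) (hε₁ : ε < 1) (hδ : 0 < δ) :
    ∃ n₀ : ℕ, ∀ n : ℕ, n₀ ≤ n → ∃ s : ℕ,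
      (s : ℝ) < δ * Real.logb 2 (1 / ε) * Real.logb 2 n ^ (c - 1) ∧
      δ * Real.logb 2 (1 / ε) * Real.logb 2 n ^ (c - 1) ≤ s + 1 ∧
      (s : ℝ) ≤ δ * Real.logb 2 n ^ c ∧
      s * (2 + Real.logb 2 (n / (δ * Real.logb 2 (1 / ε) * Real.logb 2 n ^ (c - 1))) /
        Real.logb 2 (1 / ε)) ≤ δ * Real.logb 2 n ^ c := by
  set l := Real.logb 2 (1 / ε) with hl
  have hlog : 0 < l :=
    Real.logb_pos (by norm_num) (by rw [lt_div_iff₀ hε₀]; linarith)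
  have hinf : Filter.Tendsto (fun n : ℕ => Real.logb 2 n) Filter.atTop Filter.atTop :=
    (Real.tendsto_logb_atTop (by norm_num)).comp tendsto_natCast_atTop_atTop
  suffices h : ∀ᶠ x : ℝ in Filter.atTop, ∃ s : ℕ,
      (s : ℝ) < δ * l * x ^ (c - 1) ∧ δ * l * x ^ (c - 1) ≤ s + 1 ∧ (s : ℝ) ≤ δ * x ^ c ∧
      s * (2 + (x - Real.logb 2 (δ * l * x ^ (c - 1))) / l) ≤ δ * x ^ c by
    obtain ⟨n₀, h₀⟩ := Filter.eventually_atTop.1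
      ((hinf.eventually h).and ((hinf.eventually_gt_atTop 0).and (Filter.eventually_gt_atTop 0)))
    refine ⟨n₀, fun n hn => ?_⟩
    obtain ⟨⟨s, h1, h2, h3, h4⟩, h5, h6⟩ := h₀ n hn
    refine ⟨s, h1, h2, h3, ?_⟩
    rw [Real.logb_div (by positivity) (by positivity)]
    exact h4
  have hceil : ∀ t : ℝ, 0 < t → ((⌈t⌉₊ - 1 : ℕ) : ℝ) < t ∧ t ≤ ((⌈t⌉₊ - 1 : ℕ) : ℝ) + 1 := by
    intro t ht
    have h1 : 1 ≤ ⌈t⌉₊ := Nat.one_le_ceil_iff.2 ht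
    rw [Nat.cast_sub h1]
    have := Nat.ceil_lt_add_one ht.le
    have := Nat.le_ceil t
    constructor <;> push_cast <;> linarith
  have hτx : ∀ x : ℝ, 0 < x → δ * x ^ c = δ * l * x ^ (c - 1) * x / l := by
    intro x hx
    rw [Real.rpow_sub_one hx.ne']
    field_simp
  rcases lt_trichotomy c 1 with hc | hc | hc
  · have h1 : Filter.Tendsto (fun x : ℝ => δ * l * x ^ (c - 1)) Filter.atTop (nhds (δ * l * 0)) := by
      have := tendsto_rpow_neg_atTop (y := 1 - c) (by linarith)
      simp only [neg_sub] at this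
      exact this.const_mul _
    rw [mul_zero] at h1
    filter_upwards [h1.eventually (eventually_le_nhds zero_lt_one), Filter.eventually_gt_atTop 0]
      with x hx hx0
    have hpos : 0 < δ * l * x ^ (c - 1) := by positivity
    exact ⟨0, by simpa using hpos, by simpa using hx, by simp; positivity, by simp; positivity⟩
  · subst hc
    obtain ⟨h1, h2⟩ := hceil (δ * l) (by positivity)
    set s := ⌈δ * l⌉₊ - 1
    -- This gap is why `s` is `⌈τ⌉ - 1`, strictly below `τ`, and not `⌊τ⌋`.
    have hd : 0 < δ * l - s := by linarith
    filter_upwards [Filter.eventually_gt_atTop 0, Filter.eventually_ge_atTop l,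
      Filter.eventually_ge_atTop ((s * (2 * l - Real.logb 2 (δ * l))) / (δ * l - s))] with x hx hx1 hx2
    refine ⟨s, by simpa using h1, by simpa using h2, ?_, ?_⟩
    · rw [Real.rpow_one]
      nlinarith
    · rw [div_le_iff₀ hd] at hx2
      simp only [sub_self, Real.rpow_zero, mul_one, Real.rpow_one]
      have : (s : ℝ) * (2 + (x - Real.logb 2 (δ * l)) / l) * l =
        s * (2 * l - Real.logb 2 (δ * l)) + s * x := by field_simp; ring
      refine le_of_mul_le_mul_right ?_ hlog
      rw [this]
      nlinarith
  · have h1 : Filter.Tendsto (fun x : ℝ => δ * l * x ^ (c - 1)) Filter.atTop Filter.atTop :=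
      (tendsto_rpow_atTop (by linarith)).const_mul_atTop (by positivity)
    filter_upwards [Filter.eventually_gt_atTop 0, Filter.eventually_ge_atTop l,
      ((Real.tendsto_logb_atTop (b := 2) (by norm_num)).comp h1).eventually_ge_atTop (2 * l)]
      with x hx hx1 hx2
    have hpos : 0 < δ * l * x ^ (c - 1) := by positivity
    obtain ⟨h2, h3⟩ := hceil _ hpos
    refine ⟨_, h2, h3, ?_, ?_⟩
    · rw [hτx x hx, le_div_iff₀ hlog]
      nlinarith
    · rw [hτx x hx]
      have h4 : 2 + (x - Real.logb 2 (δ * l * x ^ (c - 1))) / l ≤ x / l := by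
        rw [← sub_nonneg]
        have : x / l - (2 + (x - Real.logb 2 (δ * l * x ^ (c - 1))) / l) =
          (Real.logb 2 (δ * l * x ^ (c - 1)) - 2 * l) / l := by field_simp; ring
        rw [this]
        exact div_nonneg (sub_nonneg.2 hx2) hlog.le
      rw [mul_div_assoc]
      exact (mul_le_mul_of_nonneg_left h4 (Nat.cast_nonneg _)).trans
        (mul_le_mul_of_nonneg_right h2.le (by positivity))

/-! ### Where chains of reductions end -/

/-- If the columns of `M` can be reduced to a small set, then `M` has an efficient data
structure. -/
theorem hasLinearDataStructure_of_chain {F : Type*} [Field F] {m n : ℕ}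
    (M : Matrix (Fin m) (Fin n) F) {ε τ t : ℝ} (hε₀ : 0 < ε) (hε₁ : ε < 1) {s : ℕ}
    (hs : (s : ℝ) < τ) (hτ : τ ≤ s + 1) (ht : (s : ℝ) ≤ t)
    (ht' : s * (2 + Real.logb 2 (n / τ) / Real.logb 2 (1 / ε)) ≤ t)
    {Jf : Finset (Fin n)} (hf : Jf.card ≤ s) (h : Relation.ReflTransGen
      (fun I I' => ColumnReduction M s ⌊ε * I.card⌋₊ I I') Finset.univ Jf) :
    HasLinearDataStructure M (n / (1 - ε)) t := by
  obtain ⟨S, u, hc, hS, hu⟩ := hasCells_of_chain M hε₀ hε₁ hs hτ hf h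
  simp only [Finset.card_univ, Fintype.card_fin] at hS hu
  refine hc.hasLinearDataStructure hS ?_
  rcases hu with hu | ⟨-, hu⟩
  · exact (Nat.cast_le.2 hu).trans ht
  · exact hu.trans ht'

theorem card_lt_of_columnReduction {F : Type*} [Field F] {m n : ℕ} {M : Matrix (Fin m) (Fin n) F}
    {ε : ℝ} (hε₀ : 0 < ε) (hε₁ : ε < 1) {s : ℕ} {J J' : Finset (Fin n)} (hJ : 0 < J.card)
    (h : ColumnReduction M s ⌊ε * J.card⌋₊ J J') : J'.card < J.card := by
  refine h.2.1.trans_lt ((Nat.floor_lt (by positivity)).2 ?_)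
  have : (0 : ℝ) < J.card := by exact_mod_cast hJ
  nlinarith

/-- Reductions of a non-empty set strictly shrink it because `ε < 1`, so reducing for as long as
possible terminates. -/
theorem exists_chain_or_stuck {F : Type*} [Field F] {m n : ℕ} (M : Matrix (Fin m) (Fin n) F)
    {ε : ℝ} (hε₀ : 0 < ε) (hε₁ : ε < 1) (s : ℕ) (J : Finset (Fin n)) :
    (∃ J₁, s < J₁.card ∧ ¬ ∃ J₂, ColumnReduction M s ⌊ε * J₁.card⌋₊ J₁ J₂) ∨
    ∃ Jf : Finset (Fin n), Jf.card ≤ s ∧ Relation.ReflTransGen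
      (fun I I' => ColumnReduction M s ⌊ε * I.card⌋₊ I I') J Jf := by
  induction hk : J.card using Nat.strong_induction_on generalizing J with
  | _ k ih =>
    by_cases hs : J.card ≤ s
    · exact Or.inr ⟨J, hs, .refl⟩
    · by_cases hr : ∃ J', ColumnReduction M s ⌊ε * J.card⌋₊ J J'
      · obtain ⟨J', hJ'⟩ := hr
        rcases ih _ (hk ▸ card_lt_of_columnReduction hε₀ hε₁ (by omega) hJ') J' rfl with h | ⟨Jf, h1, h2⟩
        · exact Or.inl h
        · exact Or.inr ⟨Jf, h1, .head hJ' h2⟩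
      · exact Or.inl ⟨J, by omega, hr⟩

/-! ### Reasoning about programs -/

/-- With the oracle `O`, the program `c` started on `σ` halts within `T` steps, with a memory
satisfying `Q`. -/
def Runs (O : Set (List Bool)) (c : Cmd) (T : ℕ) (σ : Store) (Q : Store → Prop) : Prop :=
  ∃ (k : ℕ) (τ : Store), Exec O c σ k τ ∧ k ≤ T ∧ Q τ

section

variable {O : Set (List Bool)} {c d : Cmd} {T U : ℕ} {σ τ : Store} {Q R : Store → Prop}

theorem Runs.mono (h : Runs O c T σ Q) (hT : T ≤ U) (hQ : ∀ τ, Q τ → R τ) : Runs O c U σ R :=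
  let ⟨k, τ, h₁, h₂, h₃⟩ := h
  ⟨k, τ, h₁, h₂.trans hT, hQ τ h₃⟩

theorem Runs.imp (h : Runs O c T σ Q) (hQ : ∀ τ, Q τ → R τ) : Runs O c T σ R := h.mono le_rfl hQ

theorem Runs.skip (h : Q σ) : Runs O .skip 1 σ Q := ⟨1, σ, .skip σ, le_rfl, h⟩

theorem Runs.assign {a : ℕ} {i e : Expr} (h : Q (σ.write a (i.eval σ) (e.eval σ))) :
    Runs O (.assign a i e) 1 σ Q := ⟨1, _, .assign a i e σ, le_rfl, h⟩

theorem Runs.seq (h₁ : Runs O c T σ R) (h₂ : ∀ τ, R τ → Runs O d U τ Q) :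
    Runs O (.seq c d) (T + U) σ Q := by
  obtain ⟨k, τ, hk, hkT, hτ⟩ := h₁
  obtain ⟨l, υ, hl, hlU, hυ⟩ := h₂ τ hτ
  exact ⟨k + l, υ, .seq hk hl, by omega, hυ⟩

theorem Runs.ite {e : Expr} (h₁ : e.eval σ ≠ 0 → Runs O c T σ Q)
    (h₂ : e.eval σ = 0 → Runs O d U σ Q) : Runs O (.ite e c d) (T + U + 1) σ Q := by
  by_cases h : e.eval σ = 0
  · obtain ⟨k, τ, hk, hkT, hτ⟩ := h₂ h
    exact ⟨k + 1, τ, .ite_false h hk, by omega, hτ⟩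
  · obtain ⟨k, τ, hk, hkT, hτ⟩ := h₁ h
    exact ⟨k + 1, τ, .ite_true h hk, by omega, hτ⟩

/-- The rule for loops; `j` is the number of iterations that are left. -/
theorem Runs.loop {e : Expr} (I : ℕ → Store → Prop) (h₀ : ∀ σ, I 0 σ → e.eval σ = 0)
    (h₁ : ∀ j σ, I (j + 1) σ → e.eval σ ≠ 0 ∧ Runs O c T σ (I j)) {j : ℕ} (h : I j σ) :
    Runs O (.loop e c) (j * (T + 1) + 1) σ (I 0) := by
  induction j generalizing σ with
  | zero => exact ⟨1, σ, .loop_done (h₀ σ h), by omega, h⟩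
  | succ j ih =>
    obtain ⟨he, k, τ, hk, hkT, hτ⟩ := h₁ j σ h
    obtain ⟨l, υ, hl, hlU, hυ⟩ := ih hτ
    exact ⟨k + l + 1, υ, .loop_step he hk hl, by rw [add_mul]; omega, hυ⟩

end

theorem Store.write_same (σ : Store) (a i v : ℕ) : σ.write a i v a i = v := by
  simp [Store.write]

theorem Store.write_array_ne (σ : Store) {a b : ℕ} (h : b ≠ a) (i v : ℕ) : σ.write a i v b = σ b := by
  funext j; simp [Store.write, h]

theorem Store.write_array (σ : Store) (a i v : ℕ) :
    σ.write a i v a = Function.update (σ a) i v := by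
  funext j; simp [Store.write, Function.update_apply]

/-! ### Subprograms -/

/-- Rename array `a` to `B + a`. -/
def Expr.shift (B : ℕ) : Expr → Expr
  | .lit k => .lit k
  | .get a i => .get (B + a) (i.shift B)
  | .add x y => .add (x.shift B) (y.shift B)
  | .sub x y => .sub (x.shift B) (y.shift B)

/-- Rename array `a` to `B + a`, and answer all oracle queries in the negative. -/
def Cmd.embed (B : ℕ) : Cmd → Cmd
  | .skip => .skip
  | .assign a i e => .assign (B + a) (i.shift B) (e.shift B)
  | .seq c d => .seq (c.embed B) (d.embed B)
  | .ite e c d => .ite (e.shift B) (c.embed B) (d.embed B)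
  | .loop e c => .loop (e.shift B) (c.embed B)
  | .query _ b => .assign (B + b) (.lit 0) (.lit 0)

theorem Expr.eval_shift {B : ℕ} {σ σ' : Store} (h : ∀ a, σ' (B + a) = σ a) (e : Expr) :
    (e.shift B).eval σ' = e.eval σ := by
  induction e with
  | lit k => rfl
  | get a i ih => simp [Expr.shift, Expr.eval, ih, h]
  | add x y hx hy => simp [Expr.shift, Expr.eval, hx, hy]
  | sub x y hx hy => simp [Expr.shift, Expr.eval, hx, hy]

theorem Store.write_shift {B : ℕ} {σ σ' : Store} (h : ∀ a, σ' (B + a) = σ a) (b i v : ℕ) :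
    (∀ a, σ'.write (B + b) i v (B + a) = σ.write b i v a) ∧
      ∀ a < B, σ'.write (B + b) i v a = σ' a := by
  constructor
  · intro a
    funext j
    simp [Store.write, h]
  · intro a ha
    exact Store.write_array_ne _ (by omega) _ _

/-- Under the empty oracle every query is answered negatively, so an assignment of 0 has the same
effect and costs no more. Programs given without oracle thus become subroutines of programs with any
oracle, and the caller keeps its data in the arrays below `B`. -/
theorem Exec.embed {O : Set (List Bool)} {c : Cmd} {σ τ : Store} {k : ℕ} (h : Exec ∅ c σ k τ)
    (B : ℕ) {σ' : Store} (hσ : ∀ a, σ' (B + a) = σ a) :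
    Runs O (c.embed B) k σ' fun τ' => (∀ a, τ' (B + a) = τ a) ∧ ∀ a < B, τ' a = σ' a := by
  induction h generalizing σ' with
  | skip σ => exact Runs.skip ⟨hσ, fun _ _ => rfl⟩
  | assign a i e σ =>
    apply Runs.assign
    rw [Expr.eval_shift hσ, Expr.eval_shift hσ]
    exact Store.write_shift hσ _ _ _
  | seq _ _ ih₁ ih₂ =>
    exact (ih₁ hσ).seq fun τ' hτ => (ih₂ hτ.1).imp fun υ hυ =>
      ⟨hυ.1, fun a ha => (hυ.2 a ha).trans (hτ.2 a ha)⟩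
  | ite_true he _ ih =>
    obtain ⟨k, τ', h1, h2, h3⟩ := ih hσ
    exact ⟨k + 1, τ', .ite_true (by rwa [Expr.eval_shift hσ]) h1, by omega, h3⟩
  | ite_false he _ ih =>
    obtain ⟨k, τ', h1, h2, h3⟩ := ih hσ
    exact ⟨k + 1, τ', .ite_false (by rwa [Expr.eval_shift hσ]) h1, by omega, h3⟩
  | loop_step he _ _ ih₁ ih₂ =>
    obtain ⟨k, τ', h1, h2, h3⟩ := ih₁ hσ
    obtain ⟨l, υ', h4, h5, h6⟩ := ih₂ h3.1
    exact ⟨k + l + 1, υ', .loop_step (by rwa [Expr.eval_shift hσ]) h1 h4, by omega, h6.1,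
      fun a ha => (h6.2 a ha).trans (h3.2 a ha)⟩
  | loop_done he =>
    exact ⟨1, σ', .loop_done (by rwa [Expr.eval_shift hσ]), le_rfl, hσ, fun _ _ => rfl⟩
  | query_yes a b σ h => exact h.elim
  | query_no a b σ h =>
    refine Runs.mono (T := 1) (Runs.assign ?_) (by omega) fun _ h => h
    exact Store.write_shift hσ _ _ _

/-! ### Terms with bounded sums -/

/-- Terms over variables and the arrays of the memory except `2` and `3`; all sums run up to the
number in cell `0` of array `4`. -/
inductive Tm : Type
  | lit (k : ℕ) : Tm
  | var (v : ℕ) : Tm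
  | read (a : ℕ) (ha : a ≠ 2 ∧ a ≠ 3) (i : Tm) : Tm
  | add (x y : Tm) : Tm
  | sub (x y : Tm) : Tm
  | ite (x y z : Tm) : Tm
  | sum (v : ℕ) (x : Tm) : Tm

namespace Tm

/-- The value of a term. -/
def eval (σ : Store) : Tm → (ℕ → ℕ) → ℕ
  | lit k, _ => k
  | var v, ρ => ρ v
  | read a _ i, ρ => σ a (i.eval σ ρ)
  | add x y, ρ => x.eval σ ρ + y.eval σ ρ
  | sub x y, ρ => x.eval σ ρ - y.eval σ ρ
  | ite x y z, ρ => if x.eval σ ρ ≠ 0 then y.eval σ ρ else z.eval σ ρ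
  | sum v x, ρ => ∑ p ∈ Finset.range (σ 4 0), x.eval σ (Function.update ρ v p)

theorem eval_congr {σ τ : Store} (h : ∀ a, a ≠ 2 → a ≠ 3 → τ a = σ a) (x : Tm) (ρ : ℕ → ℕ) :
    x.eval τ ρ = x.eval σ ρ := by
  induction x generalizing ρ with
  | lit k => rfl
  | var v => rfl
  | read a ha i ih => simp [eval, ih, h a ha.1 ha.2]
  | add x y hx hy => simp [eval, hx, hy]
  | sub x y hx hy => simp [eval, hx, hy]
  | ite x y z hx hy hz => simp [eval, hx, hy, hz]
  | sum v x hx => simp [eval, hx, h 4]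

/-- A program that writes the value of a term into cell `t` of array `2`, using the cells from `t`
on; the values of the variables are in array `3`. -/
def compile : Tm → ℕ → Cmd
  | lit k, t => .assign 2 (.lit t) (.lit k)
  | var v, t => .assign 2 (.lit t) (.get 3 (.lit v))
  | read a _ i, t => .seq (i.compile t) (.assign 2 (.lit t) (.get a (.get 2 (.lit t))))
  | add x y, t => .seq (x.compile t) (.seq (y.compile (t + 1))
      (.assign 2 (.lit t) (.add (.get 2 (.lit t)) (.get 2 (.lit (t + 1))))))
  | sub x y, t => .seq (x.compile t) (.seq (y.compile (t + 1))
      (.assign 2 (.lit t) (.sub (.get 2 (.lit t)) (.get 2 (.lit (t + 1))))))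
  | ite x y z, t => .seq (x.compile t) (.ite (.get 2 (.lit t)) (y.compile t) (z.compile t))
  | sum v x, t =>
    .seq (.assign 2 (.lit t) (.lit 0)) <|
    .seq (.assign 2 (.lit (t + 1)) (.get 3 (.lit v))) <|
    .seq (.assign 3 (.lit v) (.lit 0)) <|
    .seq (.loop (.sub (.get 4 (.lit 0)) (.get 3 (.lit v))) <|
      .seq (x.compile (t + 2)) <|
      .seq (.assign 2 (.lit t) (.add (.get 2 (.lit t)) (.get 2 (.lit (t + 2))))) <|
      .assign 3 (.lit v) (.add (.get 3 (.lit v)) (.lit 1))) <|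
    .assign 3 (.lit v) (.get 2 (.lit (t + 1)))

open Polynomial in
/-- A bound for the running time of the compiled term. -/
noncomputable def cost : Tm → ℕ[X]
  | lit _ => 1
  | var _ => 1
  | read _ _ i => i.cost + 1
  | add x y => x.cost + (y.cost + 1)
  | sub x y => x.cost + (y.cost + 1)
  | ite x y z => x.cost + (y.cost + z.cost + 1)
  | sum _ x => 1 + (1 + (1 + ((X * (x.cost + (1 + 1) + 1) + 1) + 1)))

/-- The memory `τ` arises from `σ` by writing `v` to cell `t` of array `2`, and by changing cells
beyond it. -/
def Result (σ : Store) (t v : ℕ) (τ : Store) : Prop :=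
  (∀ a, a ≠ 2 → τ a = σ a) ∧ (∀ i < t, τ 2 i = σ 2 i) ∧ τ 2 t = v

theorem Result.write {σ τ : Store} {t u : ℕ} (h : Result σ t u τ) (v : ℕ) :
    Result σ t v (τ.write 2 t v) := by
  refine ⟨fun a ha => by rw [Store.write_array_ne _ ha, h.1 a ha], fun i hi => ?_,
    Store.write_same _ _ _ _⟩
  rw [Store.write_array, Function.update_of_ne hi.ne, h.2.1 i hi]

theorem Result.refl (σ : Store) (t : ℕ) : Result σ t (σ 2 t) σ :=
  ⟨fun _ _ => rfl, fun _ _ => rfl, rfl⟩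

theorem Result.trans {σ τ υ : Store} {t v k w : ℕ} (h : Result σ t v τ) (h' : Result τ (t + k) w υ) :
    Result σ t (υ 2 t) υ :=
  ⟨fun a ha => (h'.1 a ha).trans (h.1 a ha),
    fun i hi => (h'.2.1 i (by omega)).trans (h.2.1 i hi), rfl⟩

theorem eval_of_result {σ τ : Store} {t v : ℕ} (h : Result σ t v τ) (x : Tm) :
    x.eval τ (τ 3) = x.eval σ (σ 3) := by
  rw [h.1 3 (by omega)]
  exact eval_congr (fun a ha _ => h.1 a ha) x _

/-- Array `2` serves as a stack: a subterm only touches cells from its own level on, so partial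
results below survive. Terms cannot read arrays `2` and `3`, hence scratch work does not alter their
values, and a sum restores its variable at the end. -/
theorem runs_compile (O : Set (List Bool)) (x : Tm) (t : ℕ) (σ : Store) :
    Runs O (x.compile t) (x.cost.eval (σ 4 0)) σ (Result σ t (x.eval σ (σ 3))) := by
  induction x generalizing t σ with
  | lit k =>
    simp only [cost, Polynomial.eval_one]
    exact Runs.assign ((Result.refl σ t).write _)
  | var v =>
    simp only [cost, Polynomial.eval_one]
    exact Runs.assign ((Result.refl σ t).write _)
  | read a ha i ih =>
    simp only [cost, Polynomial.eval_add, Polynomial.eval_one]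
    refine (ih t σ).seq fun τ hτ => Runs.assign ?_
    have := hτ.write (σ a (i.eval σ (σ 3)))
    simpa [Expr.eval, eval, hτ.2.2, hτ.1 a ha.1] using this
  | add x y hx hy =>
    simp only [cost, Polynomial.eval_add, Polynomial.eval_one]
    refine (hx t σ).seq fun τ hτ => ?_
    rw [← hτ.1 4 (by omega)]
    refine (hy (t + 1) τ).seq fun υ hυ => Runs.assign ?_
    have := (hτ.trans hυ).write (x.eval σ (σ 3) + y.eval σ (σ 3))
    simpa [Expr.eval, eval, hυ.2.2, hυ.2.1 t (by omega), hτ.2.2, eval_of_result hτ] using this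
  | sub x y hx hy =>
    simp only [cost, Polynomial.eval_add, Polynomial.eval_one]
    refine (hx t σ).seq fun τ hτ => ?_
    rw [← hτ.1 4 (by omega)]
    refine (hy (t + 1) τ).seq fun υ hυ => Runs.assign ?_
    have := (hτ.trans hυ).write (x.eval σ (σ 3) - y.eval σ (σ 3))
    simpa [Expr.eval, eval, hυ.2.2, hυ.2.1 t (by omega), hτ.2.2, eval_of_result hτ] using this
  | ite x y z hx hy hz =>
    simp only [cost, Polynomial.eval_add, Polynomial.eval_one]
    refine (hx t σ).seq fun τ hτ => ?_
    rw [← hτ.1 4 (by omega)]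
    refine Runs.ite (fun h => (hy t τ).imp fun υ hυ => ?_) (fun h => (hz t τ).imp fun υ hυ => ?_)
    · have h2 := hτ.trans (k := 0) hυ
      have h0 : x.eval σ (σ 3) ≠ 0 := by simpa [Expr.eval, hτ.2.2] using h
      simpa [eval, h0, hυ.2.2, eval_of_result hτ] using h2
    · have h2 := hτ.trans (k := 0) hυ
      have h0 : x.eval σ (σ 3) = 0 := by simpa [Expr.eval, hτ.2.2] using h
      simpa [eval, h0, hυ.2.2, eval_of_result hτ] using h2
  | sum v x hx =>
    simp only [cost, Polynomial.eval_add, Polynomial.eval_one, Polynomial.eval_mul,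
      Polynomial.eval_X]
    refine Runs.seq (R := Result σ t 0) (Runs.assign ((Result.refl σ t).write 0)) fun σ₁ h₁ => ?_
    refine Runs.seq (R := fun τ => Result σ t 0 τ ∧ τ 2 (t + 1) = σ 3 v)
      (Runs.assign ⟨?_, ?_⟩) fun σ₂ h₂ => ?_
    · have := h₁.trans (k := 1) ((Result.refl σ₁ (t + 1)).write (σ 3 v))
      simpa [Expr.eval, h₁.1 3, h₁.2.2, Store.write] using this
    · simp [Expr.eval, h₁.1 3, Store.write]
    -- With `j` iterations left, variable `v` has reached the bound minus `j`, and cell `t` holds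
    -- the sum of the values before it.
    let I : ℕ → Store → Prop := fun j τ => j ≤ σ 4 0 ∧ (∀ a, a ≠ 2 → a ≠ 3 → τ a = σ a) ∧
      (∀ i < t, τ 2 i = σ 2 i) ∧ τ 2 (t + 1) = σ 3 v ∧
      τ 3 = Function.update (σ 3) v (σ 4 0 - j) ∧
      τ 2 t = ∑ p ∈ Finset.range (σ 4 0 - j), x.eval σ (Function.update (σ 3) v p)
    refine Runs.seq (R := I (σ 4 0)) (Runs.assign ⟨le_rfl, fun a ha ha' => ?_, fun i hi => ?_,
      ?_, ?_, ?_⟩) fun σ₃ h₃ => ?_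
    · rw [Store.write_array_ne _ ha', h₂.1.1 a ha]
    · rw [Store.write_array_ne _ (by omega), h₂.1.2.1 i hi]
    · rw [Store.write_array_ne _ (by omega), h₂.2]
    · simp [Store.write_array, Expr.eval, h₂.1.1 3]
    · rw [Store.write_array_ne _ (by omega), h₂.1.2.2]; simp
    refine Runs.seq (R := I 0) (Runs.loop I ?_ ?_ h₃) fun σ₄ h₄ => Runs.assign ?_
    · rintro τ ⟨-, h, -, -, h', -⟩
      simp [Expr.eval, h 4, h']
    · rintro j τ ⟨hj, h1, h2, h3, h4, h5⟩
      refine ⟨by simp [Expr.eval, h1 4, h4]; omega, ?_⟩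
      rw [← h1 4 (by omega) (by omega)]
      refine (hx (t + 2) τ).seq fun υ hυ => ?_
      have he : x.eval τ (τ 3) = x.eval σ (Function.update (σ 3) v (σ 4 0 - (j + 1))) := by
        rw [h4]; exact eval_congr h1 _ _
      have h0 : σ 4 0 - j = σ 4 0 - (j + 1) + 1 := by omega
      refine Runs.seq (R := fun ω => Result υ t (υ 2 t + υ 2 (t + 2)) ω ∧ ω 2 (t + 1) = υ 2 (t + 1))
        (Runs.assign ⟨(Result.refl υ t).write _, by simp [Store.write, Expr.eval]⟩) fun ω hω =>
          Runs.assign ⟨by omega, fun a ha ha' => ?_, fun i hi => ?_, ?_, ?_, ?_⟩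
      · rw [Store.write_array_ne _ ha', hω.1.1 a ha, hυ.1 a ha, h1 a ha ha']
      · rw [Store.write_array_ne _ (by omega), hω.1.2.1 i hi, hυ.2.1 i (by omega), h2 i hi]
      · rw [Store.write_array_ne _ (by omega), hω.2, hυ.2.1 _ (by omega), h3]
      · rw [Store.write_array, h0]
        simp [Expr.eval, hω.1.1 3, hυ.1 3, h4]
      · rw [Store.write_array_ne _ (by omega), hω.1.2.2, hυ.2.2, hυ.2.1 t (by omega), h5, h0,
          Finset.sum_range_succ, he]
    · obtain ⟨-, h1, h2, h3, h4, h5⟩ := h₄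
      refine ⟨fun a ha => ?_, fun i hi => ?_, ?_⟩
      · by_cases ha' : a = 3
        · subst ha'
          simp [Store.write_array, Expr.eval, h4, h3]
        · rw [Store.write_array_ne _ ha', h1 a ha ha']
      · rw [Store.write_array_ne _ (by omega), h2 i hi]
      · rw [Store.write_array_ne _ (by omega), h5]; rfl

end Tm

/-! ### Functions defined by terms -/

/-- For each `a`, a memory and values of the variables below `d`. -/
structure Ctx (α : Type*) where
  st : α → Store
  d : ℕ
  env : α → ℕ → ℕ

section

variable {α : Type*}

/-- The bound of all sums. -/
def Ctx.N (Γ : Ctx α) (a : α) : ℕ := Γ.st a 4 0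

/-- Add a variable. -/
def Ctx.push (Γ : Ctx α) : Ctx (α × ℕ) :=
  ⟨fun a => Γ.st a.1, Γ.d + 1, fun a => Function.update (Γ.env a.1) Γ.d a.2⟩

/-- The function `f` is the value of a term. -/
def Definable (Γ : Ctx α) (f : α → ℕ) : Prop :=
  ∃ T : Tm, ∀ a ρ, (∀ i < Γ.d, ρ i = Γ.env a i) → T.eval (Γ.st a) ρ = f a

open Classical in
/-- The truth value of `P` is the value of a term. -/
def DefinableP (Γ : Ctx α) (P : α → Prop) : Prop := Definable Γ fun a => if P a then 1 else 0

variable {Γ : Ctx α} {f g h : α → ℕ} {P Q : α → Prop}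

theorem Definable.const (k : ℕ) : Definable Γ fun _ => k := ⟨.lit k, fun _ _ _ => rfl⟩

theorem Definable.add (hf : Definable Γ f) (hg : Definable Γ g) :
    Definable Γ fun a => f a + g a := by
  obtain ⟨S, hS⟩ := hf
  obtain ⟨T, hT⟩ := hg
  exact ⟨.add S T, fun a ρ hρ => by simp [Tm.eval, hS a ρ hρ, hT a ρ hρ]⟩

theorem Definable.sub (hf : Definable Γ f) (hg : Definable Γ g) :
    Definable Γ fun a => f a - g a := by
  obtain ⟨S, hS⟩ := hf
  obtain ⟨T, hT⟩ := hg
  exact ⟨.sub S T, fun a ρ hρ => by simp [Tm.eval, hS a ρ hρ, hT a ρ hρ]⟩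

theorem Definable.read (A : ℕ) (hA : A ≠ 2 ∧ A ≠ 3) (hf : Definable Γ f) :
    Definable Γ fun a => Γ.st a A (f a) := by
  obtain ⟨S, hS⟩ := hf
  exact ⟨.read A hA S, fun a ρ hρ => by simp [Tm.eval, hS a ρ hρ]⟩

/-- The same term serves, since definability only constrains the variables below `d`. -/
theorem Definable.weaken (hf : Definable Γ f) : Definable Γ.push fun a => f a.1 := by
  obtain ⟨S, hS⟩ := hf
  refine ⟨S, fun a ρ hρ => hS a.1 ρ fun i hi => ?_⟩
  rw [hρ i (Nat.lt_succ_of_lt hi)]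
  simp [Ctx.push, Function.update_of_ne hi.ne]

theorem Definable.top (Γ : Ctx α) : Definable Γ.push fun a => a.2 :=
  ⟨.var Γ.d, fun a ρ hρ => by rw [Tm.eval, hρ _ (Nat.lt_succ_self _)]; simp [Ctx.push]⟩

theorem Definable.ite [DecidablePred P] (hP : DefinableP Γ P) (hf : Definable Γ f) (hg : Definable Γ g) :
    Definable Γ fun a => if P a then f a else g a := by
  obtain ⟨R, hR⟩ := hP
  obtain ⟨S, hS⟩ := hf
  obtain ⟨T, hT⟩ := hg
  exact ⟨.ite R S T, fun a ρ hρ => by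
    by_cases h : P a <;> simp [Tm.eval, hR a ρ hρ, hS a ρ hρ, hT a ρ hρ, h]⟩

open Classical in
theorem DefinableP.of_ne_zero (hf : Definable Γ f) : DefinableP Γ fun a => f a ≠ 0 := by
  obtain ⟨R, hR⟩ := hf
  exact ⟨.ite R (.lit 1) (.lit 0), fun a ρ hρ => by simp [Tm.eval, hR a ρ hρ]⟩

theorem DefinableP.congr (hP : DefinableP Γ P) (h : ∀ a, Q a ↔ P a) : DefinableP Γ Q := by
  rwa [show Q = P from funext fun a => propext (h a)]

theorem Definable.congr (hf : Definable Γ f) (h : ∀ a, g a = f a) : Definable Γ g := by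
  rwa [show g = f from funext h]

theorem DefinableP.lt (hf : Definable Γ f) (hg : Definable Γ g) :
    DefinableP Γ fun a => f a < g a :=
  (DefinableP.of_ne_zero (hg.sub hf)).congr fun a => by omega

theorem DefinableP.not (hP : DefinableP Γ P) : DefinableP Γ fun a => ¬ P a := by
  classical
  exact (DefinableP.of_ne_zero ((Definable.const 1).sub hP)).congr fun a => by
    by_cases h : P a <;> simp [h]

theorem DefinableP.and (hP : DefinableP Γ P) (hQ : DefinableP Γ Q) :
    DefinableP Γ fun a => P a ∧ Q a := by
  classical
  exact (DefinableP.of_ne_zero (Definable.ite hP hQ (.const 0))).congr fun a => by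
    by_cases h : P a <;> simp [h]

theorem DefinableP.or (hP : DefinableP Γ P) (hQ : DefinableP Γ Q) :
    DefinableP Γ fun a => P a ∨ Q a := (hP.not.and hQ.not).not.congr fun a => by tauto

theorem DefinableP.imp (hP : DefinableP Γ P) (hQ : DefinableP Γ Q) :
    DefinableP Γ fun a => P a → Q a := (hP.and hQ.not).not.congr fun a => by tauto

theorem DefinableP.iff (hP : DefinableP Γ P) (hQ : DefinableP Γ Q) :
    DefinableP Γ fun a => (P a ↔ Q a) := ((hP.imp hQ).and (hQ.imp hP)).congr fun a => by tauto

theorem DefinableP.le (hf : Definable Γ f) (hg : Definable Γ g) :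
    DefinableP Γ fun a => f a ≤ g a := (DefinableP.lt hg hf).not.congr fun a => by omega

theorem DefinableP.eq (hf : Definable Γ f) (hg : Definable Γ g) :
    DefinableP Γ fun a => f a = g a :=
  ((DefinableP.le hf hg).and (DefinableP.le hg hf)).congr fun a => by omega

theorem DefinableP.const (p : Prop) : DefinableP Γ fun _ => p := Definable.const _

theorem Definable.sum_N {k : α → ℕ → ℕ} (hk : Definable Γ.push fun a => k a.1 a.2) :
    Definable Γ fun a => ∑ p ∈ Finset.range (Γ.N a), k a p := by
  obtain ⟨S, hS⟩ := hk
  -- The summation variable is the first one not in use, so overwriting it leaves the environment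
  -- intact.
  refine ⟨.sum Γ.d S, fun a ρ hρ => ?_⟩
  change ∑ p ∈ Finset.range (Γ.N a), _ = _
  refine Finset.sum_congr rfl fun p _ => hS (a, p) _ fun i hi => ?_
  simp only [Ctx.push, Function.update_apply]
  split_ifs with h
  · rfl
  · exact hρ i (by simp only [Ctx.push] at hi; omega)

theorem Definable.sum {k : α → ℕ → ℕ} (hg : Definable Γ g) (hb : ∀ a, g a ≤ Γ.N a)
    (hk : Definable Γ.push fun a => k a.1 a.2) :
    Definable Γ fun a => ∑ p ∈ Finset.range (g a), k a p := by
  classical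
  -- All sums of terms run up to the common bound, so a shorter range is cut out by a test.
  have h1 : Definable Γ.push fun a => if a.2 < g a.1 then k a.1 a.2 else 0 :=
    .ite (.lt (.top Γ) hg.weaken) hk (.const 0)
  refine (Definable.sum_N (k := fun a p => if p < g a then k a p else 0) h1).congr fun a => ?_
  rw [← Finset.sum_filter]
  refine Finset.sum_congr ?_ fun _ _ => rfl
  ext p
  have := hb a
  simp only [Finset.mem_range, Finset.mem_filter]
  omega

theorem Definable.card {R : α → ℕ → Prop} [∀ a, DecidablePred (R a)] (hg : Definable Γ g) (hb : ∀ a, g a ≤ Γ.N a)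
    (hR : DefinableP Γ.push fun a => R a.1 a.2) :
    Definable Γ fun a => ((Finset.range (g a)).filter (R a)).card :=
  (Definable.sum (k := fun a p => if R a p then 1 else 0) hg hb
    (.ite (P := fun a : α × ℕ => R a.1 a.2) hR (.const 1) (.const 0))).congr fun a => by
      rw [Finset.card_filter]

theorem DefinableP.all {R : α → ℕ → Prop} (hg : Definable Γ g) (hb : ∀ a, g a ≤ Γ.N a)
    (hR : DefinableP Γ.push fun a => R a.1 a.2) :
    DefinableP Γ fun a => ∀ p < g a, R a p := by
  classical
  refine (DefinableP.eq (Definable.card (R := fun a p => ¬ R a p) hg hb hR.not)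
    (.const 0)).congr fun a => ?_
  rw [Finset.card_eq_zero, Finset.filter_eq_empty_iff]
  simp

theorem DefinableP.ex {R : α → ℕ → Prop} (hg : Definable Γ g) (hb : ∀ a, g a ≤ Γ.N a)
    (hR : DefinableP Γ.push fun a => R a.1 a.2) :
    DefinableP Γ fun a => ∃ p < g a, R a p :=
  (DefinableP.all (R := fun a p => ¬ R a p) hg hb hR.not).not.congr fun a => by simp

theorem Definable.mul (hf : Definable Γ f) (hb : ∀ a, f a ≤ Γ.N a) (hg : Definable Γ g) :
    Definable Γ fun a => f a * g a :=
  (Definable.sum (k := fun a _ => g a) hf hb hg.weaken).congr fun a => by simp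

theorem Definable.div (hf : Definable Γ f) (hb : ∀ a, f a ≤ Γ.N a) (hg : Definable Γ g)
    (hc : ∀ a, g a ≤ Γ.N a) : Definable Γ fun a => f a / g a := by
  classical
  -- The quotient is the number of `k` with `g(k+1) ≤ f`; excluding `g = 0` gives the value 0 of
  -- division by zero.
  refine (Definable.card (R := fun a k => 0 < g a ∧ g a * (k + 1) ≤ f a) hf hb
    ((DefinableP.lt (.const 0) hg.weaken).and (.le (.mul hg.weaken (fun a => hc a.1)
      ((Definable.top Γ).add (.const 1))) hf.weaken))).congr fun a => ?_
  rcases Nat.eq_zero_or_pos (g a) with h | h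
  · simp [h]
  · have : (Finset.range (f a)).filter (fun k => 0 < g a ∧ g a * (k + 1) ≤ f a) =
        Finset.range (f a / g a) := by
      ext k
      simp only [Finset.mem_filter, Finset.mem_range, h, true_and]
      rw [← Nat.succ_le_iff (n := f a / g a), Nat.le_div_iff_mul_le h, mul_comm]
      constructor
      · exact fun h => h.2
      · intro h'
        refine ⟨?_, h'⟩
        nlinarith
    rw [this, Finset.card_range]

theorem Definable.mod (hf : Definable Γ f) (hb : ∀ a, f a ≤ Γ.N a) (hg : Definable Γ g)
    (hc : ∀ a, g a ≤ Γ.N a) : Definable Γ fun a => f a % g a :=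
  (hf.sub (hg.mul hc (hf.div hb hg hc))).congr fun a => by
    have := Nat.div_add_mod (f a) (g a)
    omega

/-! ### Words as sequences of natural numbers -/

/-- The `j`-th number of a word that encodes a sequence of numbers. -/
def num : List Bool → ℕ → ℕ
  | [], _ => 0
  | true :: w, 0 => num w 0 + 1
  | true :: w, j + 1 => num w (j + 1)
  | false :: _, 0 => 0
  | false :: w, j + 1 => num w j

/-- The length of the prefix of a word that encodes `k` numbers. -/
def prefixLength : List Bool → ℕ → ℕ
  | [], _ => 0
  | _ :: _, 0 => 0
  | true :: w, k + 1 => prefixLength w (k + 1) + 1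
  | false :: w, k + 1 => prefixLength w k + 1

theorem num_encodeNats (l : List ℕ) (w : List Bool) {j : ℕ} (hj : j < l.length) :
    num (encodeNats l ++ w) j = l[j] := by
  induction l generalizing j with
  | nil => simp at hj
  | cons k l ih =>
    have : encodeNats (k :: l) ++ w = List.replicate k true ++ false :: (encodeNats l ++ w) := by
      simp [encodeNats]
    rw [this]
    clear this
    cases j with
    | zero =>
      induction k with
      | zero => simp [num]
      | succ k ihk =>
        have := ihk (by simp)
        simp_all [List.replicate_succ, num]
    | succ j =>
      induction k with
      | zero => simpa [num] using ih (by simpa using hj)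
      | succ k ihk =>
        have := ihk (by simpa using hj)
        simp_all [List.replicate_succ, num]

theorem prefixLength_encodeNats (l : List ℕ) (w : List Bool) :
    prefixLength (encodeNats l ++ w) l.length = (encodeNats l).length := by
  induction l with
  | nil => cases w <;> simp [encodeNats, prefixLength]
  | cons k l ih =>
    have : encodeNats (k :: l) = List.replicate k true ++ false :: encodeNats l := by
      simp [encodeNats]
    rw [this]
    clear this
    induction k with
    | zero => simp [prefixLength, ih]
    | succ k ihk => simpa [List.replicate_succ, prefixLength] using ihk

theorem prefixLength_le (w : List Bool) (k : ℕ) : prefixLength w k ≤ w.length := by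
  induction w generalizing k with
  | nil => simp [prefixLength]
  | cons b w ih => cases b <;> cases k <;> simp [prefixLength, ih]

theorem num_le (w : List Bool) (k : ℕ) : num w k ≤ w.length := by
  induction w generalizing k with
  | nil => simp [num]
  | cons b w ih =>
    cases b <;> cases k <;> simp [num, ih] <;> exact (ih _).trans (Nat.le_succ _)

theorem count_take (w : List Bool) (p : ℕ) : (w.take p).count false =
    ((Finset.range w.length).filter fun p' => p' < p ∧ ¬ w.getD p' false = true).card := by
  rw [Finset.card_filter]
  induction w generalizing p with
  | nil => simp
  | cons b w ih =>
    rw [List.length_cons, Finset.sum_range_succ']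
    cases p with
    | zero => simp
    | succ p => cases b <;> simp [ih]

/-- The `j`-th number is made of the bits `true` preceded by exactly `j` separators `false`.
Counting is within reach of terms, whereas the recursion defining `num` is not. -/
theorem num_eq_card (w : List Bool) (j : ℕ) : num w j = ((Finset.range w.length).filter fun p =>
    w.getD p false = true ∧ (w.take p).count false = j).card := by
  rw [Finset.card_filter]
  induction w generalizing j with
  | nil => simp [num]
  | cons b w ih =>
    rw [List.length_cons, Finset.sum_range_succ']
    cases b <;> cases j <;> simp [num, ih]

theorem prefixLength_eq_card (w : List Bool) (k : ℕ) : prefixLength w k =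
    ((Finset.range w.length).filter fun p => (w.take p).count false < k).card := by
  rw [Finset.card_filter]
  induction w generalizing k with
  | nil => simp [prefixLength]
  | cons b w ih =>
    rw [List.length_cons, Finset.sum_range_succ']
    cases b <;> cases k <;> simp [prefixLength, ih]

/-- The word `w` is kept in an array, and sums are long enough to run over its positions. -/
def HasWord (Γ : Ctx α) (w : α → List Bool) : Prop :=
  ∃ A, (A ≠ 2 ∧ A ≠ 3) ∧ ∀ a, (Γ.st a).word A = w a ∧ (w a).length ≤ Γ.N a

variable {w : α → List Bool}

theorem HasWord.push (hw : HasWord Γ w) : HasWord Γ.push fun a => w a.1 :=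
  let ⟨A, hA, h⟩ := hw
  ⟨A, hA, fun a => h a.1⟩

theorem Definable.length (hw : HasWord Γ w) : Definable Γ fun a => (w a).length := by
  obtain ⟨A, hA, h⟩ := hw
  exact (Definable.read A hA (.const 0)).congr fun a => by simp [← (h a).1, Store.word]

theorem HasWord.length_le (hw : HasWord Γ w) (a : α) : (w a).length ≤ Γ.N a :=
  let ⟨_, _, h⟩ := hw
  (h a).2

theorem DefinableP.bit (hw : HasWord Γ w) (hf : Definable Γ f) :
    DefinableP Γ fun a => (w a).getD (f a) false = true := by
  have hl := Definable.length hw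
  obtain ⟨A, hA, h⟩ := hw
  refine ((DefinableP.lt hf hl).and
    (DefinableP.of_ne_zero (Definable.read A hA (hf.add (.const 1))))).congr fun a => ?_
  rw [← (h a).1]
  by_cases h1 : f a < Γ.st a A 0 <;> simp [Store.word, List.getD, h1]

theorem Definable.count_take (hw : HasWord Γ w) (hf : Definable Γ f) :
    Definable Γ fun a => ((w a).take (f a)).count false := by
  classical
  refine (Definable.card (R := fun a p => p < f a ∧ ¬ (w a).getD p false = true) (.length hw)
    hw.length_le ((DefinableP.lt (.top Γ) hf.weaken).and
      (DefinableP.bit hw.push (.top Γ)).not)).congr fun a => ?_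
  rw [RigidityDS.count_take]

theorem Definable.num (hw : HasWord Γ w) (hf : Definable Γ f) :
    Definable Γ fun a => num (w a) (f a) := by
  classical
  refine (Definable.card (R := fun a p => (w a).getD p false = true ∧
    ((w a).take p).count false = f a) (.length hw)
    hw.length_le ((DefinableP.bit hw.push (.top Γ)).and
      (.eq (Definable.count_take hw.push (.top Γ)) hf.weaken))).congr fun a => ?_
  rw [num_eq_card]

theorem Definable.prefixLength (hw : HasWord Γ w) (hf : Definable Γ f) :
    Definable Γ fun a => prefixLength (w a) (f a) := by
  classical
  refine (Definable.card (R := fun a p => ((w a).take p).count false < f a) (.length hw)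
    hw.length_le (.lt (Definable.count_take hw.push (.top Γ)) hf.weaken)).congr fun a => ?_
  rw [prefixLength_eq_card]

/-! ### Elements of a finite field -/

/-- The element with a given number. -/
def decodeElement {F : Type*} [Field F] {q : ℕ} (e : F ≃ Fin q) (v : ℕ) : F :=
  if h : v < q then e.symm ⟨v, h⟩ else 0

theorem decodeElement_val {F : Type*} [Field F] {q : ℕ} (e : F ≃ Fin q) (u : F) :
    decodeElement e (e u : ℕ) = u := by simp [decodeElement]

/-- A case distinction over the `q` possible numbers. The field is fixed, so its arithmetic is
hard-wired into the term, one constant for each element. -/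
theorem Definable.decode {F : Type*} [Field F] {q : ℕ} (e : F ≃ Fin q) {H : F → α → ℕ}
    (hH : ∀ u, Definable Γ (H u)) (hf : Definable Γ f) :
    Definable Γ fun a => H (decodeElement e (f a)) a := by
  classical
  have key : ∀ k, Definable Γ fun a => if f a < k then H (decodeElement e (f a)) a else H 0 a := by
    intro k
    induction k with
    | zero => simpa using hH 0
    | succ k ih =>
      refine (Definable.ite (.eq hf (.const k)) (hH (decodeElement e k)) ih).congr fun a => ?_
      by_cases h : f a = k
      · simp [h]
      · rw [if_neg h]
        exact if_congr (by omega) rfl rfl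
  refine (key q).congr fun a => ?_
  split_ifs with h
  · rfl
  · rw [decodeElement, dif_neg h]

theorem DefinableP.decode {F : Type*} [Field F] {q : ℕ} (e : F ≃ Fin q) {R : F → α → Prop}
    (hR : ∀ u, DefinableP Γ (R u)) (hf : Definable Γ f) :
    DefinableP Γ fun a => R (decodeElement e (f a)) a := by
  classical
  exact Definable.decode e (H := fun u a => if R u a then 1 else 0) hR hf

end

/-! ### Building blocks of programs -/

theorem eval_mono (p : Polynomial ℕ) {a b : ℕ} (h : a ≤ b) : p.eval a ≤ p.eval b := by
  rw [Polynomial.eval_eq_sum_range, Polynomial.eval_eq_sum_range]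
  gcongr

/-- Run `c` as often as the value of `e` says; cell `0` of array `A` is the counter. -/
def Cmd.rep (A : ℕ) (e : Expr) (c : Cmd) : Cmd :=
  .seq (.assign A (.lit 0) e) <| .loop (.get A (.lit 0)) <|
    .seq c (.assign A (.lit 0) (.sub (.get A (.lit 0)) (.lit 1)))

/-- `J i` describes the memory after `i` rounds. It must tolerate writes to the counter cell, which
the loop itself changes. -/
theorem runs_rep {O : Set (List Bool)} {c : Cmd} {T A v : ℕ} {e : Expr} {σ : Store}
    (J : ℕ → Store → Prop) (hv : e.eval σ = v) (hw : ∀ i σ v, J i σ → J i (σ.write A 0 v))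
    (hc : ∀ i σ, i < v → J i σ → Runs O c T σ fun τ => J (i + 1) τ ∧ τ A 0 = σ A 0)
    (hσ : J 0 σ) : Runs O (.rep A e c) (1 + (v * (T + 1 + 1) + 1)) σ (J v) := by
  let I : ℕ → Store → Prop := fun j τ => j ≤ v ∧ τ A 0 = j ∧ J (v - j) τ
  refine Runs.seq (R := I v) (Runs.assign ⟨le_rfl, ?_, ?_⟩) fun τ hτ => ?_
  · simp [Expr.eval, Store.write, hv]
  · rw [Nat.sub_self]; exact hw _ _ _ hσ
  refine (Runs.loop I ?_ ?_ hτ).imp fun τ hτ => by simpa using hτ.2.2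
  · rintro τ ⟨-, h, -⟩
    exact h
  · rintro j τ ⟨h1, h2, h3⟩
    refine ⟨by simp [Expr.eval, h2], (hc _ τ (by omega) h3).seq fun υ hυ => Runs.assign ?_⟩
    refine ⟨by omega, by simp [Expr.eval, Store.write, hυ.2, h2], hw _ _ _ ?_⟩
    rw [show v - j = v - (j + 1) + 1 by omega]
    exact hυ.1

/-- Append a bit to the word in array `A`. -/
def Cmd.push (A : ℕ) (e : Expr) : Cmd :=
  .seq (.assign A (.add (.get A (.lit 0)) (.lit 1)) e)
    (.assign A (.lit 0) (.add (.get A (.lit 0)) (.lit 1)))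

theorem word_congr {σ τ : Store} {a b : ℕ} (h : τ a = σ b) : τ.word a = σ.word b := by
  simp [Store.word, h]

theorem length_word (σ : Store) (a : ℕ) : (σ.word a).length = σ a 0 := by simp [Store.word]

theorem runs_push (O : Set (List Bool)) (A : ℕ) (e : Expr) (σ : Store) :
    Runs O (.push A e) 2 σ fun τ => τ.word A = σ.word A ++ [decide (e.eval σ ≠ 0)] ∧
      ∀ a, a ≠ A → τ a = σ a := by
  refine Runs.seq (T := 1) (U := 1) (R := fun τ => τ = σ.write A (σ A 0 + 1) (e.eval σ))
    (Runs.assign (by simp [Expr.eval])) ?_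
  rintro τ rfl
  refine Runs.assign ⟨?_, fun a ha => ?_⟩
  · simp only [Store.word, Expr.eval, Store.write_array]
    simp only [Function.update_self, Function.update_of_ne (Nat.succ_ne_zero _).symm, ne_eq]
    rw [List.range_succ, List.map_append, List.map_singleton]
    congr 1
    · refine List.map_congr_left fun i hi => ?_
      have := List.mem_range.1 hi
      rw [Function.update_of_ne (by omega), Function.update_of_ne (by omega)]
    · simp
  · rw [Store.write_array_ne _ ha, Store.write_array_ne _ ha]

/-- Write a number in unary into the word in array `10`; the counter is in array `6`. -/
def Cmd.unary (e : Expr) : Cmd :=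
  .seq (.assign 10 (.lit 0) e) (.rep 6 (.get 10 (.lit 0)) (.assign 10 (.get 6 (.lit 0)) (.lit 1)))

theorem runs_unary (O : Set (List Bool)) {e : Expr} {σ : Store} {v : ℕ} (hv : e.eval σ = v)
    (h0 : ∀ a i, 10 ≤ a → σ a i = 0) :
    Runs O (.unary e) (3 + v * 3) σ fun τ =>
      (∀ a, τ (10 + a) = initStore [List.replicate v true] a) ∧
        ∀ a, a < 10 → a ≠ 6 → τ a = σ a := by
  -- The counter runs down and is also the index written to, so the ones are filled in from the top.
  -- Arrays from `10` on must start at zero in order to look like a fresh initial memory to the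
  -- subroutine.
  let K : ℕ → Store → Prop := fun j τ => τ 10 0 = v ∧
    (∀ i, τ 10 (i + 1) = if j ≤ i ∧ i < v then 1 else 0) ∧ (∀ a, a ≠ 6 → a ≠ 10 → τ a = σ a)
  refine (Runs.seq (T := 1) (U := 2 + v * 3) (R := K v) (Runs.assign ⟨?_, fun i => ?_, ?_⟩)
    fun τ hτ => ?_).mono (by omega) fun _ h => h
  · simp [Store.write, Expr.eval, hv]
  · rw [if_neg (by omega)]
    simp [Store.write, Expr.eval, h0]
  · exact fun a _ h => Store.write_array_ne _ h _ _
  let I : ℕ → Store → Prop := fun j τ => K j τ ∧ τ 6 0 = j ∧ j ≤ v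
  refine Runs.mono (T := 1 + (v * (1 + 1 + 1) + 1)) (Q := I 0) ?_ (by omega) ?_
  · refine Runs.seq (R := I v) (Runs.assign ⟨⟨?_, fun i => ?_, fun a h h' => ?_⟩, ?_, le_rfl⟩)
      fun τ hτ => ?_
    · simpa [Store.write] using hτ.1
    · simpa [Store.write] using hτ.2.1 i
    · rw [Store.write_array_ne _ h]; exact hτ.2.2 a h h'
    · simpa [Store.write, Expr.eval] using hτ.1
    refine Runs.loop I (fun τ hτ => by simpa [Expr.eval] using hτ.2.1) ?_ hτ
    rintro j τ ⟨⟨h1, h2, h3⟩, h4, hj⟩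
    refine ⟨by simp [Expr.eval, h4], Runs.seq (R := fun υ => K j υ ∧ υ 6 0 = j + 1)
      (Runs.assign ⟨⟨?_, fun i => ?_, fun a h h' => ?_⟩, ?_⟩) fun υ hυ =>
        Runs.assign ⟨⟨?_, fun i => ?_, fun a h h' => ?_⟩, ?_, by omega⟩⟩
    · simpa [Store.write, Expr.eval, h4] using h1
    · simp only [Store.write_array, Expr.eval, h4, Function.update_apply, h2]
      split_ifs <;> omega
    · rw [Store.write_array_ne _ h', h3 a h h']
    · simpa [Store.write] using h4
    · simpa [Store.write] using hυ.1.1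
    · simpa [Store.write] using hυ.1.2.1 i
    · rw [Store.write_array_ne _ h]; exact hυ.1.2.2 a h h'
    · simp [Store.write, Expr.eval, hυ.2]
  · rintro τ ⟨⟨h1, h2, h3⟩, -⟩
    refine ⟨fun a => ?_, fun a ha ha' => h3 a ha' (by omega)⟩
    funext i
    rcases Nat.eq_zero_or_pos a with rfl | ha
    · cases i with
      | zero => simpa [initStore] using h1
      | succ i =>
        rw [h2]
        by_cases hi : i < v <;> simp [initStore, List.getD, hi]
    · rw [h3 _ (by omega) (by omega), h0 _ _ (by omega)]
      obtain ⟨a, rfl⟩ := Nat.exists_eq_succ_of_ne_zero ha.ne'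
      cases i <;> simp [initStore]

/-! ### Verifiers -/

/-- `φ` is defined by a term in every context in which its arguments are available. -/
def UniformP (φ : List Bool → List Bool → ℕ → Prop) : Prop :=
  ∀ {α : Type} (Γ : Ctx α) (x y : α → List Bool) (r : α → ℕ), HasWord Γ x → HasWord Γ y →
    Definable Γ r → DefinableP Γ fun a => φ (x a) (y a) (r a)

/-- `f` is defined by a term in every context in which its argument is available. -/
def Uniform (f : List Bool → ℕ) : Prop :=
  ∀ {α : Type} (Γ : Ctx α) (x : α → List Bool), HasWord Γ x → Definable Γ fun a => f (x a)

theorem word_initStore (ws : List (List Bool)) (a : ℕ) : (initStore ws).word a = ws.getD a [] := by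
  have key : ∀ l : List Bool, ((List.range l.length).map fun i =>
      decide ((if l.getD i false = true then 1 else 0) ≠ 0)) = l := fun l => by
    apply List.ext_getElem
    · simp
    · intro i h1 h2
      simp [h2]
  exact key _

-- The program computes `g x` by a term, writes it in unary into array `10`, runs the given program
-- for `f` in the arrays from `10` on, and evaluates `φ` by a second term. Running `f` as a
-- subroutine is necessary because `⌊εk⌋` is only assumed computable, not definable by a term.
open Classical in
theorem polyTime_verifier {f : ℕ → ℕ}
    (hf : PolyTimeUnary ∅ fun n => List.replicate (f n) true) {g : List Bool → ℕ} (hg : Uniform g)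
    (hgb : ∀ x, g x ≤ x.length) {φ : List Bool → List Bool → ℕ → Prop} (hφ : UniformP φ) :
    PolyTime ∅ (fun z : List Bool × List Bool => [z.1, z.2])
      (fun z => [decide (φ z.1 z.2 (f (g z.1)))]) := by
  -- Applying uniformity to the context of all memories with a large enough bound yields one term
  -- for all inputs.
  obtain ⟨S, hS⟩ : ∃ S : Tm, ∀ σ ρ, (σ.word 0).length ≤ σ 4 0 → S.eval σ ρ = g (σ.word 0) := by
    obtain ⟨S, hS⟩ := hg (α := {σ : Store // (σ.word 0).length ≤ σ 4 0})
      ⟨fun a => a.1, 0, fun _ _ => 0⟩ (fun a => a.1.word 0) ⟨0, by omega, fun a => ⟨rfl, a.2⟩⟩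
    exact ⟨S, fun σ ρ h => hS ⟨σ, h⟩ ρ (by simp)⟩
  obtain ⟨T, hT⟩ : ∃ T : Tm, ∀ σ ρ, (σ.word 0).length ≤ σ 4 0 → (σ.word 1).length ≤ σ 4 0 →
      T.eval σ ρ = if φ (σ.word 0) (σ.word 1) (σ 10 0) then 1 else 0 := by
    obtain ⟨T, hT⟩ := hφ
      (α := {σ : Store // (σ.word 0).length ≤ σ 4 0 ∧ (σ.word 1).length ≤ σ 4 0})
      ⟨fun a => a.1, 0, fun _ _ => 0⟩ (fun a => a.1.word 0) (fun a => a.1.word 1)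
      (fun a => a.1 10 0) ⟨0, by omega, fun a => ⟨rfl, a.2.1⟩⟩ ⟨1, by omega, fun a => ⟨rfl, a.2.2⟩⟩
      (Definable.read 10 (by omega) (.const 0))
    exact ⟨T, fun σ ρ h h' => hT ⟨σ, h, h'⟩ ρ (by simp)⟩
  obtain ⟨c, p, hp⟩ := hf
  refine ⟨.seq (.assign 4 (.lit 0) (.add (.get 0 (.lit 0)) (.get 1 (.lit 0)))) <|
    .seq (S.compile 0) <| .seq (.unary (.get 2 (.lit 0))) <| .seq (c.embed 10) <|
    .seq (T.compile 0) <| .seq (.assign 0 (.lit 1) (.get 2 (.lit 0))) (.assign 0 (.lit 0) (.lit 1)),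
    1 + (S.cost + ((3 + Polynomial.X * 3) + (p + (T.cost + (1 + 1))))) + 1, fun z => ?_⟩
  obtain ⟨x, y⟩ := z
  set N := x.length + y.length with hN
  have hsum : ([x, y].map List.length).sum = N := by simp [hN]
  simp only [hsum, Polynomial.eval_add, Polynomial.eval_one, Polynomial.eval_mul,
    Polynomial.eval_X, Polynomial.eval_ofNat]
  suffices h : Runs ∅ (.seq (.assign 4 (.lit 0) (.add (.get 0 (.lit 0)) (.get 1 (.lit 0)))) <|
      .seq (S.compile 0) <| .seq (.unary (.get 2 (.lit 0))) <| .seq (c.embed 10) <|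
      .seq (T.compile 0) <| .seq (.assign 0 (.lit 1) (.get 2 (.lit 0)))
        (.assign 0 (.lit 0) (.lit 1)))
      (1 + (S.cost.eval N + ((3 + N * 3) + (p.eval N + (T.cost.eval N + (1 + 1))))))
      (initStore [x, y]) fun τ => τ.word 0 = [decide (φ x y (f (g x)))] by
    obtain ⟨k, τ, h1, h2, h3⟩ := h
    exact ⟨k, τ, h1, h3, by simpa using h2⟩
  refine Runs.seq (R := fun τ => τ 4 0 = N ∧ ∀ a, a ≠ 4 → τ a = initStore [x, y] a)
    (Runs.assign ⟨by simp [Store.write, Expr.eval, initStore, hN],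
      fun a ha => Store.write_array_ne _ ha _ _⟩) fun σ₁ h₁ => ?_
  have hx₁ : σ₁.word 0 = x := by
    rw [word_congr (h₁.2 0 (by omega)), word_initStore]; rfl
  have hy₁ : σ₁.word 1 = y := by
    rw [word_congr (h₁.2 1 (by omega)), word_initStore]; rfl
  have hlx : (σ₁.word 0).length ≤ σ₁ 4 0 := by rw [hx₁, h₁.1]; omega
  have hly : (σ₁.word 1).length ≤ σ₁ 4 0 := by rw [hy₁, h₁.1]; omega
  rw [← h₁.1]
  refine (S.runs_compile ∅ 0 σ₁).seq fun σ₂ h₂ => ?_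
  have hr : σ₂ 2 0 = g x := by rw [h₂.2.2, hS _ _ hlx, hx₁]
  have hgN : g x ≤ σ₁ 4 0 := by rw [h₁.1]; exact (hgb x).trans (by omega)
  have hz : ∀ a i, 10 ≤ a → σ₂ a i = 0 := by
    intro a i ha
    rw [h₂.1 a (by omega), h₁.2 a (by omega)]
    obtain ⟨a, rfl⟩ := Nat.exists_eq_add_of_le ha
    cases i <;> simp [initStore, List.getD, show 10 + a = a + 8 + 2 by omega]
  refine Runs.seq ((runs_unary ∅ (show (Expr.get 2 (.lit 0)).eval σ₂ = g x from hr) hz).mono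
    (by omega) fun _ h => h) fun σ₃ h₃ => ?_
  obtain ⟨k, τ, hk, hτ, hkp⟩ := hp (g x)
  have hkN : k ≤ p.eval (σ₁ 4 0) := by
    have := eval_mono p hgN
    simp only [List.map_cons, List.length_replicate, List.map_nil, List.sum_cons, List.sum_nil,
      add_zero] at hkp
    omega
  refine Runs.seq ((hk.embed 10 h₃.1).mono hkN fun _ h => h) fun σ₄ h₄ => ?_
  have hkeep : ∀ a < 10, a ≠ 2 → a ≠ 6 → σ₄ a = σ₁ a := fun a ha h2 h6 => by
    rw [h₄.2 a ha, h₃.2 a ha h6, h₂.1 a h2]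
  -- The output of the subroutine is a number in unary, so its value is the length kept in cell 0.
  have hf4 : σ₄ 10 0 = f (g x) := by
    have := congrArg List.length hτ
    rw [length_word, List.length_replicate] at this
    rw [← this]
    exact congrFun (h₄.1 0) 0
  have hev : T.eval σ₄ (σ₄ 3) = if φ x y (f (g x)) then 1 else 0 := by
    have e0 : σ₄.word 0 = σ₁.word 0 := word_congr (hkeep 0 (by omega) (by omega) (by omega))
    have e1 : σ₄.word 1 = σ₁.word 1 := word_congr (hkeep 1 (by omega) (by omega) (by omega))
    have e4 : σ₄ 4 = σ₁ 4 := hkeep 4 (by omega) (by omega) (by omega)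
    rw [hT _ _ (by rw [e0, e4]; exact hlx) (by rw [e1, e4]; exact hly), e0, e1, hx₁, hy₁, hf4]
  rw [← hkeep 4 (by omega) (by omega) (by omega)]
  refine (T.runs_compile ∅ 0 σ₄).seq fun σ₅ h₅ => ?_
  refine Runs.seq (R := fun τ => τ 0 1 = if φ x y (f (g x)) then 1 else 0)
    (Runs.assign (by simp [Store.write, Expr.eval, h₅.2.2, hev])) fun σ₆ h₆ => Runs.assign ?_
  simp [Store.word, Store.write, Expr.eval, h₆]

/-! ### Adaptive queries -/

open Classical in
/-- Append the answer of the oracle about a word to that word. -/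
noncomputable def answerStep (O : Set (List Bool)) (w : List Bool) : List Bool :=
  w ++ [decide (w ∈ O)]

theorem length_iterate_answerStep (O : Set (List Bool)) (i : ℕ) (w : List Bool) :
    ((answerStep O)^[i] w).length = w.length + i := by
  induction i with
  | zero => rfl
  | succ i ih => rw [Function.iterate_succ_apply', answerStep, List.length_append, ih]; rfl

/-- The program `c` appends `K` answers to the word in array `10`, as long as this word has length
at most `M`, and changes no array below `A`. -/
def Appends (O : Set (List Bool)) (b M : ℕ) (c : Cmd) (A K T : ℕ) : Prop :=
  ∀ σ : Store, σ 5 0 = b → (σ.word 10).length + K ≤ M → Runs O c T σ fun τ =>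
    τ.word 10 = (answerStep O)^[K] (σ.word 10) ∧ ∀ a < A, τ a = σ a

theorem appends_step (O : Set (List Bool)) (b M : ℕ) :
    Appends O b M (.seq (.query 10 9) (.push 10 (.get 9 (.lit 0)))) 9 1 (M + 1 + 2) := by
  classical
  intro σ _ hM
  refine Runs.seq (R := fun τ => (∀ a, a ≠ 9 → τ a = σ a) ∧
    τ 9 0 = if σ.word 10 ∈ O then 1 else 0) ?_ fun τ hτ => ?_
  · by_cases h : σ.word 10 ∈ O
    · exact ⟨_, _, .query_yes 10 9 σ h, by omega, fun a ha => Store.write_array_ne _ ha _ _,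
        by simp [Store.write, h]⟩
    · exact ⟨_, _, .query_no 10 9 σ h, by omega, fun a ha => Store.write_array_ne _ ha _ _,
        by simp [Store.write, h]⟩
  · refine (runs_push O 10 _ τ).imp fun υ hυ => ⟨?_, fun a ha => ?_⟩
    · rw [hυ.1, word_congr (hτ.1 10 (by omega))]
      simp only [Expr.eval, hτ.2, Function.iterate_one, answerStep]
      by_cases h : σ.word 10 ∈ O <;> simp [h]
    · rw [hυ.2 a (by omega), hτ.1 a (by omega)]

/-- Each nesting multiplies the number of answers by `b`; the body preserves array `A`, which holds
the counter. The cap `M` on the word length bounds the cost of every query. -/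
theorem Appends.rep {O : Set (List Bool)} {b M : ℕ} {c : Cmd} {A K T : ℕ}
    (h : Appends O b M c (A + 1) K T) (hA : 5 < A) (hA' : A < 10) :
    Appends O b M (.rep A (.get 5 (.lit 0)) c) A (b * K) (1 + (b * (T + 1 + 1) + 1)) := by
  intro σ hb hM
  refine (runs_rep (v := b) (fun i τ => τ.word 10 = (answerStep O)^[i * K] (σ.word 10) ∧
    ∀ a < A, τ a = σ a) (show (Expr.get 5 (.lit 0)).eval σ = b from hb) ?_ ?_ (by simp)).imp
      fun _ h => h
  · rintro i τ v ⟨h1, h2⟩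
    exact ⟨by rw [← h1]; exact word_congr (Store.write_array_ne _ (by omega) _ _),
      fun a ha => by rw [Store.write_array_ne _ (by omega), h2 a ha]⟩
  · rintro i τ hi ⟨h1, h2⟩
    refine (h τ (by rw [h2 5 hA, hb]) ?_).imp fun υ hυ => ⟨⟨?_, fun a ha => ?_⟩, ?_⟩
    · rw [h1, length_iterate_answerStep]
      have : (i + 1) * K ≤ b * K := Nat.mul_le_mul_right K hi
      rw [add_mul, one_mul] at this
      omega
    · rw [hυ.1, h1, ← Function.iterate_add_apply]
      congr 1
      ring_nf
    · rw [hυ.2 a (by omega), h2 a ha]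
    · rw [hυ.2 A (by omega)]

/-! ### Writing a list of numbers -/

/-- A number in unary, closed by `false`. -/
def encodeNat (k : ℕ) : List Bool := List.replicate k true ++ [false]

/-- Append a number, in unary, to the word in array `0`. -/
def Cmd.pushNat (e : Expr) : Cmd := .seq (.rep 6 e (.push 0 (.lit 1))) (.push 0 (.lit 0))

theorem runs_pushNat (O : Set (List Bool)) {e : Expr} {σ : Store} {v : ℕ} (hv : e.eval σ = v) :
    Runs O (.pushNat e) (1 + (v * (2 + 1 + 1) + 1) + 2) σ fun τ =>
      τ.word 0 = σ.word 0 ++ encodeNat v ∧ ∀ a, a ≠ 0 → a ≠ 6 → τ a = σ a := by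
  refine Runs.seq (runs_rep (v := v) (fun i τ => τ.word 0 = σ.word 0 ++ List.replicate i true ∧
    ∀ a, a ≠ 0 → a ≠ 6 → τ a = σ a) hv ?_ ?_ (by simp)) fun τ hτ => ?_
  · rintro i τ v ⟨h1, h2⟩
    exact ⟨by rw [← h1]; exact word_congr (Store.write_array_ne _ (by omega) _ _),
      fun a ha ha' => by rw [Store.write_array_ne _ ha', h2 a ha ha']⟩
  · rintro i τ hi ⟨h1, h2⟩
    refine (runs_push O 0 _ τ).imp fun υ hυ => ⟨⟨?_, fun a ha ha' => ?_⟩, ?_⟩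
    · rw [hυ.1, h1, List.replicate_succ']
      simp [Expr.eval]
    · rw [hυ.2 a ha, h2 a ha ha']
    · rw [hυ.2 6 (by omega)]
  · refine (runs_push O 0 _ τ).imp fun υ hυ => ⟨?_, fun a ha ha' => ?_⟩
    · rw [hυ.1, hτ.1]
      simp [Expr.eval, encodeNat]
    · rw [hυ.2 a ha, hτ.2 a ha ha']

/-- `P` is defined by a term in every context in which its arguments are available. -/
def UniformAtP (P : List Bool → ℕ → Prop) : Prop :=
  ∀ {α : Type} (Γ : Ctx α) (x : α → List Bool) (t : α → ℕ), HasWord Γ x →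
    Definable Γ t → DefinableP Γ fun a => P (x a) (t a)

/-- `f` is defined by a term in every context in which its arguments are available. -/
def UniformAt (f : List Bool → ℕ → ℕ) : Prop :=
  ∀ {α : Type} (Γ : Ctx α) (x : α → List Bool) (t : α → ℕ), HasWord Γ x →
    Definable Γ t → Definable Γ fun a => f (x a) (t a)

theorem UniformAt.exists_term {f : List Bool → ℕ → ℕ} (hf : UniformAt f) :
    ∃ T : Tm, ∀ σ : Store, (σ.word 10).length ≤ σ 4 0 →
      T.eval σ (σ 3) = f (σ.word 10) (σ 3 0) := by
  obtain ⟨T, hT⟩ := hf (α := {σ : Store // (σ.word 10).length ≤ σ 4 0})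
    ⟨fun a => a.1, 1, fun a => a.1 3⟩ (fun a => a.1.word 10) (fun a => a.1 3 0)
    ⟨10, by omega, fun a => ⟨rfl, a.2⟩⟩ ⟨.var 0, fun a ρ h => h 0 Nat.one_pos⟩
  exact ⟨T, fun σ h => hT ⟨σ, h⟩ _ fun _ _ => rfl⟩

open Classical in
theorem UniformAtP.exists_term {P : List Bool → ℕ → Prop} (hP : UniformAtP P) :
    ∃ T : Tm, ∀ σ : Store, (σ.word 10).length ≤ σ 4 0 →
      T.eval σ (σ 3) = if P (σ.word 10) (σ 3 0) then 1 else 0 :=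
  UniformAt.exists_term (f := fun w t => if P w t then 1 else 0) hP

open Classical in
/-- The list of the values of `val` at those arguments below the length that satisfy `cond`. -/
noncomputable def listOutput (cond : List Bool → ℕ → Prop) (val : List Bool → ℕ → ℕ)
    (w : List Bool) : List ℕ :=
  ((List.range w.length).filter fun t => cond w t).map (val w)

/-- Write the encoded `listOutput`. -/
def outputCmd (S T : Tm) : Cmd :=
  .seq (.assign 0 (.lit 0) (.lit 0)) <| .seq (.assign 3 (.lit 0) (.lit 0)) <|
  .loop (.sub (.get 4 (.lit 0)) (.get 3 (.lit 0))) <|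
    .seq (S.compile 0) <|
    .seq (.ite (.get 2 (.lit 0)) (.seq (T.compile 0) (.pushNat (.get 2 (.lit 0)))) .skip) <|
    .assign 3 (.lit 0) (.add (.get 3 (.lit 0)) (.lit 1))

theorem runs_output (O : Set (List Bool)) {cond : List Bool → ℕ → Prop}
    {val : List Bool → ℕ → ℕ} (hval : ∀ w t, val w t ≤ w.length) {S T : Tm}
    (hS : ∀ σ : Store, (σ.word 10).length ≤ σ 4 0 →
      S.eval σ (σ 3) = open Classical in if cond (σ.word 10) (σ 3 0) then 1 else 0)
    (hT : ∀ σ : Store, (σ.word 10).length ≤ σ 4 0 →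
      T.eval σ (σ 3) = val (σ.word 10) (σ 3 0)) {σ : Store} {w : List Bool} {N : ℕ}
    (hw : σ.word 10 = w) (h4 : σ 4 0 = N) (hN : w.length = N) :
    Runs O (outputCmd S T) (1 + (1 + (N * (S.cost.eval N + ((T.cost.eval N +
      (1 + (N * (2 + 1 + 1) + 1) + 2)) + 1 + 1 + 1) + 1) + 1))) σ fun τ =>
        τ.word 0 = encodeNats (listOutput cond val w) := by
  classical
  let I : ℕ → Store → Prop := fun j τ => j ≤ N ∧ τ.word 10 = w ∧ τ 4 0 = N ∧ τ 3 0 = N - j ∧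
    τ.word 0 = encodeNats (((List.range (N - j)).filter fun t => cond w t).map (val w))
  refine Runs.seq (R := fun τ => τ.word 10 = w ∧ τ 4 0 = N ∧ τ.word 0 = []) (Runs.assign
    ⟨?_, ?_, ?_⟩) fun σ₁ h₁ => Runs.seq (R := I N) (Runs.assign ⟨le_rfl, ?_, ?_, ?_, ?_⟩)
      fun σ₂ h₂ => ?_
  · rw [← hw]; exact word_congr (Store.write_array_ne _ (by omega) _ _)
  · rw [Store.write_array_ne _ (by omega), h4]
  · simp [Store.word, Store.write, Expr.eval]
  · rw [← h₁.1]; exact word_congr (Store.write_array_ne _ (by omega) _ _)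
  · rw [Store.write_array_ne _ (by omega), h₁.2.1]
  · simp [Store.write, Expr.eval]
  · rw [word_congr (Store.write_array_ne _ (by omega) _ _), h₁.2.2]; simp [encodeNats]
  refine (Runs.loop I ?_ ?_ h₂).imp fun τ hτ => by
    rw [hτ.2.2.2.2, Nat.sub_zero, listOutput, hN]
  · rintro τ ⟨-, -, h1, h2, -⟩
    simp [Expr.eval, h1, h2]
  · rintro j τ ⟨hj, h1, h2, h3, h5⟩
    have hl : (τ.word 10).length ≤ τ 4 0 := by rw [h1, h2, hN]
    have hs : N - j = N - (j + 1) + 1 := by omega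
    refine ⟨by simp [Expr.eval, h2, h3]; omega, Runs.seq (R := Tm.Result τ 0
      (if cond w (N - (j + 1)) then 1 else 0)) ?_ fun τ₁ t₁ => ?_⟩
    · have := S.runs_compile O 0 τ
      rwa [hS τ hl, h1, h2, h3] at this
    have hl₁ : (τ₁.word 10).length ≤ τ₁ 4 0 := by
      rw [word_congr (t₁.1 10 (by omega)), t₁.1 4 (by omega)]; exact hl
    have h1' : τ₁.word 10 = w := by rw [word_congr (t₁.1 10 (by omega)), h1]
    have h3' : τ₁ 3 0 = N - (j + 1) := by rw [t₁.1 3 (by omega), h3]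
    have h4' : τ₁ 4 0 = N := by rw [t₁.1 4 (by omega), h2]
    refine Runs.seq (R := fun υ => υ.word 10 = w ∧ υ 4 0 = N ∧ υ 3 0 = N - (j + 1) ∧ υ.word 0 =
      encodeNats (((List.range (N - j)).filter fun t => cond w t).map (val w)))
      (Runs.ite (fun h => ?_) (fun h => ?_)) fun τ₂ t₂ => Runs.assign ⟨by omega, ?_, ?_, ?_, ?_⟩
    · have hc : cond w (N - (j + 1)) := by
        by_contra hc
        simp [Expr.eval, t₁.2.2, hc] at h
      refine Runs.seq (R := Tm.Result τ₁ 0 (val w (N - (j + 1)))) ?_ fun τ₂ t₂ => ?_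
      · have := T.runs_compile O 0 τ₁
        rwa [hT τ₁ hl₁, h1', h3', h4'] at this
      refine (runs_pushNat O (show (Expr.get 2 (.lit 0)).eval τ₂ = _ from t₂.2.2)).mono ?_
        fun υ hυ => ⟨?_, ?_, ?_, ?_⟩
      · have := hval w (N - (j + 1))
        rw [hN] at this
        gcongr
      · rw [word_congr (hυ.2 10 (by omega) (by omega)), word_congr (t₂.1 10 (by omega)), h1']
      · rw [hυ.2 4 (by omega) (by omega), t₂.1 4 (by omega), h4']
      · rw [hυ.2 3 (by omega) (by omega), t₂.1 3 (by omega), h3']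
      · rw [hυ.1, word_congr (t₂.1 0 (by omega)), word_congr (t₁.1 0 (by omega)), h5, hs,
          List.range_succ, List.filter_append, List.map_append]
        simp [hc, encodeNats, encodeNat]
    · have hc : ¬ cond w (N - (j + 1)) := by
        intro hc
        simp [Expr.eval, t₁.2.2, hc] at h
      refine Runs.skip ⟨h1', h4', h3', ?_⟩
      rw [word_congr (t₁.1 0 (by omega)), h5, hs, List.range_succ, List.filter_append]
      simp [hc]
    · rw [← t₂.1]; exact word_congr (Store.write_array_ne _ (by omega) _ _)
    · rw [Store.write_array_ne _ (by omega), t₂.2.1]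
    · simp [Store.write, Expr.eval, t₂.2.2.1, hs]
    · rw [word_congr (Store.write_array_ne _ (by omega) _ _), t₂.2.2.2]

theorem length_encodeNats_le {l : List ℕ} {B : ℕ} (h : ∀ k ∈ l, k ≤ B) :
    (encodeNats l).length ≤ l.length * (B + 1) := by
  induction l with
  | nil => simp [encodeNats]
  | cons k l ih =>
    have h1 := ih fun k hk => h k (List.mem_cons_of_mem _ hk)
    have h2 := h k List.mem_cons_self
    simp only [encodeNats, List.flatMap_cons, List.length_append, List.length_replicate,
      List.length_cons, List.length_nil, add_mul, one_mul] at h1 ⊢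
    omega

/-- After the subroutine has written the starting word into array `10`, three nested loops of length
`b` append `b³` oracle answers to it, and the output is read off the resulting word by terms. That
word has length `b + b³`, with `b` polynomial in `n`. -/
theorem polyTime_adaptive (O : Set (List Bool)) {w₀ : ℕ → List Bool} (hw₀ : PolyTimeUnary ∅ w₀)
    {cond : List Bool → ℕ → Prop} (hcond : UniformAtP cond) {val : List Bool → ℕ → ℕ}
    (hval : UniformAt val) (hvb : ∀ w t, val w t ≤ w.length) :
    PolyTimeUnary O fun n => encodeNats (listOutput cond val
      ((answerStep O)^[(w₀ n).length * ((w₀ n).length * ((w₀ n).length * 1))] (w₀ n))) := by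
  obtain ⟨S, hS⟩ := hcond.exists_term
  obtain ⟨T, hT⟩ := hval.exists_term
  obtain ⟨c, p, hp⟩ := hw₀
  let N : Polynomial ℕ := .X + .X * (.X * (.X * 1))
  let q : Polynomial ℕ := (1 + ((1 + (.X * ((1 + (.X * ((1 + (.X * ((N + 1 + 2) + 1 + 1) + 1)) +
    1 + 1) + 1)) + 1 + 1) + 1)) + (1 + (1 + (1 + (N * (S.cost.comp N + ((T.cost.comp N +
      (1 + (N * (2 + 1 + 1) + 1) + 2)) + 1 + 1 + 1) + 1) + 1)))))) + N * (N + 1)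
  refine ⟨.seq (.unary (.get 0 (.lit 0))) <| .seq (c.embed 10) <|
    .seq (.assign 5 (.lit 0) (.get 10 (.lit 0))) <|
    .seq (.rep 6 (.get 5 (.lit 0)) <| .rep 7 (.get 5 (.lit 0)) <| .rep 8 (.get 5 (.lit 0)) <|
      .seq (.query 10 9) (.push 10 (.get 9 (.lit 0)))) <|
    .seq (.assign 4 (.lit 0) (.get 10 (.lit 0))) <| outputCmd S T,
    3 + .X * 3 + p + q.comp p, fun n => ?_⟩
  set w := w₀ n with hw
  obtain ⟨k, τ, hk, hτ, hkp⟩ := hp n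
  simp only [List.map_cons, List.map_nil, List.sum_cons, List.sum_nil, List.length_replicate,
    add_zero] at hkp ⊢
  set b := w.length with hb
  set wf := (answerStep O)^[b * (b * (b * 1))] w with hwf
  have hwfl : wf.length = N.eval b := by
    rw [hwf, length_iterate_answerStep]; simp [N, hb]
  -- The output length counts towards the time. At most `N` numbers of size at most `N` are written
  -- in unary, which gives the summand `N * (N + 1)` of `q`.
  have hout : (encodeNats (listOutput cond val wf)).length ≤ N.eval b * (N.eval b + 1) := by
    refine (length_encodeNats_le (B := N.eval b) ?_).trans (Nat.mul_le_mul_right _ ?_)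
    · intro k hk
      simp only [listOutput, List.mem_map] at hk
      obtain ⟨t, -, rfl⟩ := hk
      rw [← hwfl]
      exact hvb _ _
    · rw [listOutput, List.length_map, ← hwfl]
      exact (List.length_filter_le _ _).trans (by simp)
  have hqb : q.eval b ≤ q.eval (p.eval n) := eval_mono q (by omega)
  suffices h : Runs O (.seq (.unary (.get 0 (.lit 0))) <| .seq (c.embed 10) <|
      .seq (.assign 5 (.lit 0) (.get 10 (.lit 0))) <|
      .seq (.rep 6 (.get 5 (.lit 0)) <| .rep 7 (.get 5 (.lit 0)) <| .rep 8 (.get 5 (.lit 0)) <|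
        .seq (.query 10 9) (.push 10 (.get 9 (.lit 0)))) <|
      .seq (.assign 4 (.lit 0) (.get 10 (.lit 0))) <| outputCmd S T)
      (3 + n * 3 + (k + (q.eval b - N.eval b * (N.eval b + 1))))
      (initStore [List.replicate n true])
      fun τ => τ.word 0 = encodeNats (listOutput cond val wf) by
    obtain ⟨k', τ', h1, h2, h3⟩ := h
    refine ⟨k', τ', h1, h3, ?_⟩
    have : N.eval b * (N.eval b + 1) ≤ q.eval b := by simp [q]
    simp only [Polynomial.eval_add, Polynomial.eval_mul, Polynomial.eval_X,
      Polynomial.eval_ofNat, Polynomial.eval_comp] at *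
    omega
  refine Runs.seq (runs_unary O (v := n) (by simp [Expr.eval, initStore]) ?_) fun σ₁ h₁ => ?_
  · intro a i ha
    obtain ⟨a, rfl⟩ := Nat.exists_eq_add_of_le ha
    cases i <;> simp [initStore, List.getD, show 10 + a = a + 9 + 1 by omega]
  refine Runs.seq (hk.embed 10 h₁.1) fun σ₂ h₂ => ?_
  have hw₂ : σ₂.word 10 = w := by rw [word_congr (h₂.1 0), hτ]
  refine Runs.mono (T := 1 + ((1 + (b * ((1 + (b * ((1 + (b * ((N.eval b + 1 + 2) + 1 + 1) + 1)) +
    1 + 1) + 1)) + 1 + 1) + 1)) + (1 + (1 + (1 + (N.eval b * (S.cost.eval (N.eval b) +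
    ((T.cost.eval (N.eval b) + (1 + (N.eval b * (2 + 1 + 1) + 1) + 2)) + 1 + 1 + 1) + 1) + 1))))))
    (Q := fun τ => τ.word 0 = encodeNats (listOutput cond val wf)) ?_ ?_ fun _ h => h
  · refine Runs.seq (R := fun τ => τ.word 10 = w ∧ τ 5 0 = b) (Runs.assign ⟨?_, ?_⟩)
      fun σ₃ h₃ => ?_
    · rw [← hw₂]; exact word_congr (Store.write_array_ne _ (by omega) _ _)
    · simp [Store.write, Expr.eval, hb, ← hw₂, length_word]
    have happ := (((appends_step O b (N.eval b)).rep (A := 8) (by omega) (by omega)).rep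
      (A := 7) (by omega) (by omega)).rep (A := 6) (by omega) (by omega)
    refine Runs.seq (happ σ₃ h₃.2 ?_) fun σ₄ h₄ => ?_
    · rw [h₃.1, ← hb]; simp [N]
    rw [h₃.1] at h₄
    refine Runs.seq (R := fun τ => τ.word 10 = wf ∧ τ 4 0 = N.eval b) (Runs.assign ⟨?_, ?_⟩)
      fun σ₅ h₅ => ?_
    · rw [word_congr (Store.write_array_ne _ (by omega) _ _), h₄.1]
    · rw [← hwfl, hwf, ← h₄.1, length_word]
      simp [Store.write, Expr.eval]
    exact runs_output O hvb hS hT h₅.1 h₅.2 hwfl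
  · simp [q]

/-! ### Words that consist of an encoded matrix and of answers of the oracle

The answers come in blocks. The length `b` of the code of the matrix is the length of each block.
Answer `c` of block `b * s + k` tells whether column `c` is removed in the `k`-th
reduction, when `s` changes per row are allowed. -/

/-- The number of rows. -/
def rowCount (x : List Bool) : ℕ := num x 0

/-- The number of columns. -/
def colCount (x : List Bool) : ℕ := num x 1

/-- The length of the code of the matrix. -/
def codeLength (x : List Bool) : ℕ := prefixLength x (rowCount x * colCount x + 2)

/-- The number of an entry. -/
def entry (x : List Bool) (i j : ℕ) : ℕ := num x (2 + (colCount x * i + j))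

/-- An answer of the oracle. -/
def Answer (x : List Bool) (t : ℕ) : Prop := x.getD (codeLength x + t) false = true

/-- The number of answers. -/
def answerCount (x : List Bool) : ℕ := x.length - codeLength x

/-- Column `j` is present after `k` reductions. -/
def Active (x : List Bool) (s k j : ℕ) : Prop :=
  j < colCount x ∧ ∀ k' < k, ¬ Answer x (codeLength x * (codeLength x * s + k') + j)

open Classical in
/-- The number of columns present after `k` reductions. -/
noncomputable def activeCount (x : List Bool) (s k : ℕ) : ℕ :=
  ((Finset.range (colCount x)).filter (Active x s k)).card

/-- The block of the next answer. -/
def nextBlock (x : List Bool) : ℕ := answerCount x / codeLength x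

/-- The number of changes allowed for the next answer. -/
def nextChanges (x : List Bool) : ℕ := nextBlock x / codeLength x

/-- The number of the reduction to which the next answer belongs. -/
def nextRound (x : List Bool) : ℕ := nextBlock x % codeLength x

open Classical in
/-- The word `y` describes a reduction to at most `r` columns, consistent with the answers in `x`, in
which the column of the next answer is removed. -/
def Witness {F : Type*} [Field F] {q : ℕ} (e : F ≃ Fin q) (x y : List Bool) (r : ℕ) : Prop :=
  (∀ j < colCount x, num y j ≠ 0 → Active x (nextChanges x) (nextRound x) j) ∧
  ((Finset.range (colCount x)).filter fun j => num y j ≠ 0).card ≤ r ∧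
  (∀ j < answerCount x % codeLength x, j < colCount x →
    (num y j ≠ 0 ↔ ¬ Answer x (codeLength x * nextBlock x + j))) ∧
  num y (answerCount x % codeLength x) = 0 ∧
  (∀ i < rowCount x, ((Finset.range (colCount x)).filter fun j =>
    Active x (nextChanges x) (nextRound x) j ∧
      ¬ decodeElement e (num y (codeLength x + (codeLength x * i + j))) =
        decodeElement e (entry x i j)).card ≤ nextChanges x) ∧
  ∀ i < rowCount x, ∀ j < colCount x, Active x (nextChanges x) (nextRound x) j →
    decodeElement e (num y (codeLength x + 2 * (codeLength x * codeLength x) +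
      (codeLength x * (codeLength x * i + j) + 0))) = decodeElement e q ∧
    decodeElement e (num y (codeLength x + 2 * (codeLength x * codeLength x) +
      (codeLength x * (codeLength x * i + j) + colCount x))) =
        decodeElement e (num y (codeLength x + (codeLength x * i + j))) ∧
    ∀ a < colCount x,
      (num y a = 0 → decodeElement e (num y (codeLength x + 2 * (codeLength x * codeLength x) +
        (codeLength x * (codeLength x * i + j) + (a + 1)))) =
          decodeElement e (num y (codeLength x + 2 * (codeLength x * codeLength x) +
            (codeLength x * (codeLength x * i + j) + a)))) ∧
      (num y a ≠ 0 → decodeElement e (num y (codeLength x + 2 * (codeLength x * codeLength x) +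
        (codeLength x * (codeLength x * i + j) + (a + 1)))) =
          decodeElement e (num y (codeLength x + 2 * (codeLength x * codeLength x) +
            (codeLength x * (codeLength x * i + j) + a))) +
          decodeElement e (num y (codeLength x + (codeLength x * i + a))) *
          decodeElement e (num y (codeLength x + codeLength x * codeLength x +
            (codeLength x * a + j))))

/-- The columns after the last reduction, for the largest number `s` of changes for which more
than `s` columns are left. -/
def Selected (x : List Bool) (j : ℕ) : Prop :=
  ∃ s < codeLength x, (s < activeCount x s (codeLength x) ∧ ∀ s' < codeLength x, s < s' →
    ¬ s' < activeCount x s' (codeLength x)) ∧ Active x s (codeLength x) j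

open Classical in
/-- The numbers in the code of the selected columns. -/
noncomputable def selectedValue (x : List Bool) (t : ℕ) : ℕ :=
  if t = 1 then ((Finset.range (colCount x)).filter (Selected x)).card else num x t

/-- The positions in the code of the matrix that are kept in the code of the selected columns. -/
def SelectedPosition (x : List Bool) (t : ℕ) : Prop :=
  t < 2 ∨ ∃ i < rowCount x, ∃ j < colCount x, t = 2 + (colCount x * i + j) ∧ Selected x j

/-! ### Definability -/

theorem rowCount_le (x : List Bool) : rowCount x ≤ x.length := num_le x 0

theorem colCount_le (x : List Bool) : colCount x ≤ x.length := num_le x 1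

theorem codeLength_le (x : List Bool) : codeLength x ≤ x.length := prefixLength_le x _

theorem answerCount_le (x : List Bool) : answerCount x ≤ x.length := Nat.sub_le _ _

theorem nextBlock_le (x : List Bool) : nextBlock x ≤ x.length :=
  (Nat.div_le_self _ _).trans (answerCount_le x)

theorem nextRound_le (x : List Bool) : nextRound x ≤ x.length :=
  (Nat.mod_le _ _).trans (nextBlock_le x)

section

variable {α : Type*} {Γ : Ctx α} {x y : α → List Bool} {f g h k : α → ℕ}

theorem HasWord.le_of_le {l : List Bool → ℕ} (hl : ∀ w, l w ≤ w.length) (hx : HasWord Γ x) (a : α) :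
    l (x a) ≤ Γ.N a := (hl _).trans (hx.length_le a)

theorem Definable.rowCount (hx : HasWord Γ x) : Definable Γ fun a => rowCount (x a) :=
  .num hx (.const 0)

theorem Definable.colCount (hx : HasWord Γ x) : Definable Γ fun a => colCount (x a) :=
  .num hx (.const 1)

theorem Definable.codeLength (hx : HasWord Γ x) : Definable Γ fun a => codeLength (x a) :=
  .prefixLength hx (.add (.mul (.rowCount hx) (hx.le_of_le rowCount_le) (.colCount hx)) (.const 2))

theorem Definable.codeLength_mul (hx : HasWord Γ x) (hf : Definable Γ f) :
    Definable Γ fun a => RigidityDS.codeLength (x a) * f a :=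
  .mul (.codeLength hx) (hx.le_of_le codeLength_le) hf

theorem Definable.entry (hx : HasWord Γ x) (hf : Definable Γ f) (hg : Definable Γ g) :
    Definable Γ fun a => entry (x a) (f a) (g a) :=
  .num hx (.add (.const 2) (.add (.mul (.colCount hx) (hx.le_of_le colCount_le) hf) hg))

theorem DefinableP.answer (hx : HasWord Γ x) (hf : Definable Γ f) :
    DefinableP Γ fun a => Answer (x a) (f a) :=
  .bit hx (.add (.codeLength hx) hf)

theorem Definable.answerCount (hx : HasWord Γ x) : Definable Γ fun a => answerCount (x a) :=
  .sub (.length hx) (.codeLength hx)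

theorem DefinableP.active (hx : HasWord Γ x) (hf : Definable Γ f) (hg : Definable Γ g)
    (hb : ∀ a, g a ≤ Γ.N a) (hh : Definable Γ h) :
    DefinableP Γ fun a => Active (x a) (f a) (g a) (h a) :=
  .and (.lt hh (.colCount hx)) (.all hg hb (DefinableP.answer hx.push
    (.add (.codeLength_mul hx.push (.add (.codeLength_mul hx.push hf.weaken) (.top Γ)))
      hh.weaken)).not)

theorem Definable.activeCount (hx : HasWord Γ x) (hf : Definable Γ f) (hg : Definable Γ g)
    (hb : ∀ a, g a ≤ Γ.N a) : Definable Γ fun a => activeCount (x a) (f a) (g a) := by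
  classical
  exact .card (.colCount hx) (hx.le_of_le colCount_le)
    (.active hx.push hf.weaken hg.weaken (fun a => hb a.1) (.top Γ))

theorem Definable.nextBlock (hx : HasWord Γ x) : Definable Γ fun a => nextBlock (x a) :=
  .div (.answerCount hx) (hx.le_of_le answerCount_le) (.codeLength hx) (hx.le_of_le codeLength_le)

theorem Definable.nextChanges (hx : HasWord Γ x) : Definable Γ fun a => nextChanges (x a) :=
  .div (.nextBlock hx) (hx.le_of_le nextBlock_le) (.codeLength hx) (hx.le_of_le codeLength_le)

theorem Definable.nextRound (hx : HasWord Γ x) : Definable Γ fun a => nextRound (x a) :=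
  .mod (.nextBlock hx) (hx.le_of_le nextBlock_le) (.codeLength hx) (hx.le_of_le codeLength_le)

theorem Definable.nextColumn (hx : HasWord Γ x) :
    Definable Γ fun a => RigidityDS.answerCount (x a) % RigidityDS.codeLength (x a) :=
  .mod (.answerCount hx) (hx.le_of_le answerCount_le) (.codeLength hx) (hx.le_of_le codeLength_le)

theorem DefinableP.active_next (hx : HasWord Γ x) (hh : Definable Γ h) :
    DefinableP Γ fun a => Active (x a) (nextChanges (x a)) (nextRound (x a)) (h a) :=
  .active hx (.nextChanges hx) (.nextRound hx) (hx.le_of_le nextRound_le) hh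

theorem DefinableP.decode_eq {F : Type*} [Field F] {q : ℕ} (e : F ≃ Fin q) (hf : Definable Γ f)
    (hg : Definable Γ g) : DefinableP Γ fun a => decodeElement e (f a) = decodeElement e (g a) :=
  .decode e (R := fun u a => u = decodeElement e (g a))
    (fun u => .decode e (R := fun v _ => u = v) (fun _ => .const _) hg) hf

theorem DefinableP.decode_eq_add_mul {F : Type*} [Field F] {q : ℕ} (e : F ≃ Fin q)
    (hf : Definable Γ f) (hg : Definable Γ g) (hh : Definable Γ h) (hk : Definable Γ k) :
    DefinableP Γ fun a => decodeElement e (f a) =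
      decodeElement e (g a) + decodeElement e (h a) * decodeElement e (k a) :=
  .decode e (R := fun u a => u =
    decodeElement e (g a) + decodeElement e (h a) * decodeElement e (k a)) (fun u =>
    .decode e (R := fun v a => u = v + decodeElement e (h a) * decodeElement e (k a)) (fun v =>
    .decode e (R := fun v' a => u = v + v' * decodeElement e (k a)) (fun v' =>
    .decode e (R := fun v'' _ => u = v + v' * v'') (fun _ => .const _) hk) hh) hg) hf

/-- Positions in `y` of a table with two arguments. -/
theorem Definable.num_table (hx : HasWord Γ x) (hy : HasWord Γ y) (hk : Definable Γ k)
    (hf : Definable Γ f) (hg : Definable Γ g) : Definable Γ fun a =>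
      RigidityDS.num (y a) (k a + (RigidityDS.codeLength (x a) * f a + g a)) :=
  .num hy (.add hk (.add (.codeLength_mul hx hf) hg))

end

/-- The conditions are bounded quantifications, counts and single field operations. An unbounded sum
of field elements would not be definable in this way, which is why the witness contains all partial
sums of `∑ L i a * C a j`. -/
theorem witness_uniform {F : Type*} [Field F] {q : ℕ} (e : F ≃ Fin q) : UniformP (Witness e) := by
  classical
  intro α Γ x y r hx hy hr
  have hc := hx.le_of_le colCount_le
  refine .and ?_ (.and ?_ (.and ?_ (.and ?_ (.and ?_ ?_))))
  · exact .all (.colCount hx) hc (.imp (.of_ne_zero (.num hy.push (.top Γ)))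
      (.active_next hx.push (.top Γ)))
  · exact .le (.card (.colCount hx) hc (.of_ne_zero (.num hy.push (.top Γ)))) hr
  · exact .all (.nextColumn hx) (fun a => (Nat.mod_le _ _).trans (hx.le_of_le answerCount_le a))
      (.imp (.lt (.top Γ) (.colCount hx.push)) (.iff (.of_ne_zero (.num hy.push (.top Γ)))
        (DefinableP.answer hx.push
          (.add (.codeLength_mul hx.push (.nextBlock hx.push)) (.top Γ))).not))
  · exact .eq (.num hy (.nextColumn hx)) (.const 0)
  · exact .all (.rowCount hx) (hx.le_of_le rowCount_le) (.le (.card (.colCount hx.push)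
      (fun a => hc a.1) (.and (.active_next hx.push.push (.top _)) (DefinableP.decode_eq e
        (.num_table hx.push.push hy.push.push (.codeLength hx.push.push)
          (Definable.top Γ).weaken (.top _))
        (.entry hx.push.push (Definable.top Γ).weaken (.top _))).not)) (.nextChanges hx.push))
  · refine .all (.rowCount hx) (hx.le_of_le rowCount_le) (.all (.colCount hx.push)
      (fun a => hc a.1) (.imp (.active_next hx.push.push (.top _)) ?_))
    have hi : Definable Γ.push.push fun a => a.1.2 := (Definable.top Γ).weaken
    have hj : Definable Γ.push.push fun a => a.2 := .top _
    have hP : ∀ {β : Type} {Δ : Ctx β} {x y : β → List Bool} {i j a : β → ℕ}, HasWord Δ x →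
        HasWord Δ y → Definable Δ i → Definable Δ j → Definable Δ a → Definable Δ fun c =>
          num (y c) (codeLength (x c) + 2 * (codeLength (x c) * codeLength (x c)) +
            (codeLength (x c) * (codeLength (x c) * i c + j c) + a c)) := by
      intro β Δ x y i j a hx hy hi hj ha
      refine .num_table hx hy (.add (.codeLength hx) ?_) (.add (.codeLength_mul hx hi) hj) ha
      -- Products need a first factor below the sum bound, which is not known for the constant 2,
      -- hence a sum.
      exact (Definable.add (.codeLength_mul hx (.codeLength hx))
        (.codeLength_mul hx (.codeLength hx))).congr fun c => two_mul _
    refine .and (.decode_eq e (hP hx.push.push hy.push.push hi hj (.const 0)) (.const q)) (.and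
      (.decode_eq e (hP hx.push.push hy.push.push hi hj (.colCount hx.push.push))
        (.num_table hx.push.push hy.push.push (.codeLength hx.push.push) hi hj))
      (.all (.colCount hx.push.push) (fun a => hc a.1.1) ?_))
    have hx' := hx.push.push.push
    have hy' := hy.push.push.push
    have ha : Definable Γ.push.push.push fun a => a.2 := .top _
    exact .and
      (.imp (.eq (.num hy' ha) (.const 0)) (.decode_eq e
        (hP hx' hy' hi.weaken hj.weaken (.add ha (.const 1))) (hP hx' hy' hi.weaken hj.weaken ha)))
      (.imp (.of_ne_zero (.num hy' ha)) (.decode_eq_add_mul e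
        (hP hx' hy' hi.weaken hj.weaken (.add ha (.const 1)))
        (hP hx' hy' hi.weaken hj.weaken ha)
        (.num_table hx' hy' (.codeLength hx') hi.weaken ha)
        (.num_table hx' hy' (.add (.codeLength hx') (.codeLength_mul hx' (.codeLength hx')))
          ha hj.weaken)))

theorem uniform_activeCount : Uniform fun x => activeCount x (nextChanges x) (nextRound x) :=
  fun _ _ hx => .activeCount hx (.nextChanges hx) (.nextRound hx) (hx.le_of_le nextRound_le)

theorem activeCount_le (x : List Bool) (s k : ℕ) : activeCount x s k ≤ x.length := by
  classical
  exact (Finset.card_filter_le _ _).trans (by simpa using colCount_le x)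

theorem DefinableP.selected {α : Type*} {Γ : Ctx α} {x : α → List Bool} {f : α → ℕ}
    (hx : HasWord Γ x) (hf : Definable Γ f) : DefinableP Γ fun a => Selected (x a) (f a) := by
  have hb := hx.le_of_le codeLength_le
  refine .ex (.codeLength hx) hb (.and (.and (.lt (.top Γ) (.activeCount hx.push (.top Γ)
    (.codeLength hx.push) fun a => hb a.1)) (.all (.codeLength hx.push) (fun a => hb a.1)
      (.imp (.lt (Definable.top Γ).weaken (.top _)) ?_)))
        (.active hx.push (.top Γ) (.codeLength hx.push) (fun a => hb a.1) hf.weaken))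
  exact (DefinableP.lt (.top _) (.activeCount hx.push.push (.top _)
    (.codeLength hx.push.push) fun a => hb a.1.1)).not

theorem selectedValue_uniform : UniformAt selectedValue := by
  classical
  intro α Γ x t hx ht
  exact .ite (.eq ht (.const 1)) (.card (.colCount hx) (hx.le_of_le colCount_le)
    (.selected hx.push (.top Γ))) (.num hx ht)

theorem selectedPosition_uniform : UniformAtP SelectedPosition := by
  intro α Γ x t hx ht
  refine .or (.lt ht (.const 2)) (.ex (.rowCount hx) (hx.le_of_le rowCount_le)
    (.ex (.colCount hx.push) (fun a => hx.le_of_le colCount_le a.1) (.and (.eq ht.weaken.weaken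
      (.add (.const 2) (.add (.mul (.colCount hx.push.push) (fun a => hx.le_of_le colCount_le a.1.1)
        (Definable.top Γ).weaken) (.top _)))) (.selected hx.push.push (.top _)))))

theorem selectedValue_le (x : List Bool) (t : ℕ) : selectedValue x t ≤ x.length := by
  classical
  rw [selectedValue]
  split_ifs
  · exact (Finset.card_filter_le _ _).trans (by simpa using colCount_le x)
  · exact num_le x t

/-! ### Reading the code of a matrix -/

theorem length_encodeNats (l : List ℕ) : (encodeNats l).length = l.sum + l.length := by
  induction l with
  | nil => rfl
  | cons k l ih =>
    simp only [encodeNats, List.flatMap_cons, List.length_append, List.length_replicate,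
      List.length_cons, List.length_nil, List.sum_cons] at ih ⊢
    omega

theorem range_mul_filter_map (m n : ℕ) (c : ℕ → Bool) (G : ℕ → ℕ) :
    ((List.range (m * n)).filter c).map G = (List.range m).flatMap fun i =>
      ((List.range n).filter fun j => c (n * i + j)).map fun j => G (n * i + j) := by
  induction m with
  | zero => simp
  | succ m ih =>
    rw [add_mul, one_mul, List.range_add, List.filter_append, List.map_append, ih, List.range_succ,
      List.flatMap_append, List.flatMap_singleton, List.filter_map, List.map_map, mul_comm m n]
    rfl

section

variable {F : Type*} {q : ℕ} (e : F ≃ Fin q) {m n : ℕ} (M : Matrix (Fin m) (Fin n) F)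

/-- The numbers of the entries, row by row. -/
def entryNumber (t : ℕ) : ℕ :=
  if h : t / n < m ∧ t % n < n then e (M ⟨t / n, h.1⟩ ⟨t % n, h.2⟩) else 0

theorem entryNumber_eq (i : Fin m) (j : Fin n) : entryNumber e M (n * i + j) = e (M i j) := by
  have h1 : (n * (i : ℕ) + j) / n = i := by
    rw [Nat.mul_add_div j.pos, Nat.div_eq_of_lt j.2, add_zero]
  have h2 : (n * (i : ℕ) + j) % n = j := by
    rw [Nat.mul_add_mod, Nat.mod_eq_of_lt j.2]
  rw [entryNumber, dif_pos ⟨by rw [h1]; exact i.2, by rw [h2]; exact j.2⟩]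
  congr 3 <;> exact Fin.ext (by assumption)

theorem encodeMatrix_eq : encodeMatrix e M =
    encodeNats (m :: n :: (List.range (m * n)).map (entryNumber e M)) := by
  have h := range_mul_filter_map m n (fun _ => true) (entryNumber e M)
  simp only [List.filter_true] at h
  rw [encodeMatrix, h, ← List.map_coe_finRange_eq_range (n := m), List.flatMap_map]
  congr 3
  refine congrArg (fun g => List.flatMap g _) (funext fun i => ?_)
  rw [← List.map_coe_finRange_eq_range, List.map_map]
  refine List.map_congr_left fun j _ => ?_
  exact (entryNumber_eq e M i j).symm

theorem le_length_encodeMatrix : m + n + m * n + 2 ≤ (encodeMatrix e M).length := by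
  rw [encodeMatrix_eq, length_encodeNats]
  simp only [List.sum_cons, List.length_cons, List.length_map, List.length_range]
  omega

variable (Z : List Bool)

theorem rowCount_encodeMatrix : rowCount (encodeMatrix e M ++ Z) = m := by
  rw [rowCount, encodeMatrix_eq, num_encodeNats _ _ (by simp)]; rfl

theorem colCount_encodeMatrix : colCount (encodeMatrix e M ++ Z) = n := by
  rw [colCount, encodeMatrix_eq, num_encodeNats _ _ (by simp)]; rfl

theorem codeLength_encodeMatrix :
    codeLength (encodeMatrix e M ++ Z) = (encodeMatrix e M).length := by
  rw [codeLength, rowCount_encodeMatrix, colCount_encodeMatrix, encodeMatrix_eq]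
  rw [← prefixLength_encodeNats _ Z]
  congr 1
  simp

theorem num_encodeMatrix (t : ℕ) (ht : t < m * n) :
    num (encodeMatrix e M ++ Z) (2 + t) = entryNumber e M t := by
  rw [encodeMatrix_eq, num_encodeNats _ _ (by simp; omega)]
  simp [Nat.add_comm 2 t]

theorem entry_encodeMatrix (i : Fin m) (j : Fin n) :
    entry (encodeMatrix e M ++ Z) i j = e (M i j) := by
  have h : n * (i : ℕ) + j < m * n := by
    have h1 : n * (i + 1) ≤ n * m := Nat.mul_le_mul_left n i.2
    have := j.2
    rw [mul_comm m n]
    rw [mul_add, mul_one] at h1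
    omega
  rw [entry, colCount_encodeMatrix, num_encodeMatrix e M Z _ h, entryNumber_eq]

theorem answer_encodeMatrix (t : ℕ) :
    Answer (encodeMatrix e M ++ Z) t ↔ Z.getD t false = true := by
  rw [Answer, codeLength_encodeMatrix]
  simp [List.getD, List.getElem?_append_right]

theorem answerCount_encodeMatrix : answerCount (encodeMatrix e M ++ Z) = Z.length := by
  rw [answerCount, codeLength_encodeMatrix]
  simp

/-! ### The output -/

theorem map_orderEmbOfFin (J : Finset (Fin n)) :
    (List.finRange J.card).map (J.orderEmbOfFin rfl) =
      (List.finRange n).filter fun j => decide (j ∈ J) := by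
  refine List.Perm.eq_of_pairwise (le := (· < ·)) (fun a b _ _ h h' => absurd h (lt_asymm h')) ?_ ?_ ?_
  · rw [List.pairwise_map]
    exact (List.pairwise_lt_finRange _).imp fun h => (J.orderEmbOfFin rfl).lt_iff_lt.2 h
  · exact (List.pairwise_lt_finRange _).filter _
  · rw [List.perm_ext_iff_of_nodup]
    · intro j
      simp
    · exact (List.nodup_finRange _).map (J.orderEmbOfFin rfl).injective
    · exact (List.nodup_finRange _).filter _

theorem card_range_filter (n : ℕ) (R : ℕ → Prop) [DecidablePred R] :
    ((Finset.range n).filter R).card = {j : Fin n | R j}.ncard := by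
  classical
  rw [Set.ncard_eq_toFinset_card', Set.toFinset_ofPred, Finset.card_filter, Finset.card_filter,
    Finset.sum_range]

open Classical in
/-- The columns that remain. -/
noncomputable def selectedColumns (x : List Bool) (n : ℕ) : Finset (Fin n) :=
  Finset.univ.filter fun j => Selected x j

/-- Numbers 0 and 1 of the code are the dimensions, the second being replaced by the number of
selected columns. Number `2 + (n * i + j)` is kept exactly when column `j` is selected, and scanning
upwards preserves the row-by-row order. -/
theorem listOutput_encodeMatrix {x : List Bool} (hx : x = encodeMatrix e M ++ Z) :
    encodeNats (listOutput SelectedPosition selectedValue x) =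
      encodeMatrix e (M.submatrix id ((selectedColumns x n).orderEmbOfFin rfl)) := by
  classical
  have hr : rowCount x = m := hx ▸ rowCount_encodeMatrix e M Z
  have hc : colCount x = n := hx ▸ colCount_encodeMatrix e M Z
  have hl : 2 + m * n ≤ x.length := by
    have := le_length_encodeMatrix e M
    rw [hx, List.length_append]; omega
  -- The scan runs over the whole word length; the positions from `2 + m * n` on contribute nothing.
  obtain ⟨d, hd⟩ := Nat.exists_eq_add_of_le hl
  have h1 : ∀ t, ¬ SelectedPosition x (2 + m * n + t) := by
    rintro t (h | ⟨i, hi, j, hj, h, -⟩)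
    · omega
    · rw [hr] at hi; rw [hc] at hj h
      have h1 : n * (i + 1) ≤ n * m := Nat.mul_le_mul_left n hi
      rw [mul_add, mul_one, mul_comm n m] at h1
      omega
  have h2 : ∀ i < m, ∀ j < n, (SelectedPosition x (2 + (n * i + j)) ↔ Selected x j) := by
    intro i hi j hj
    constructor
    · rintro (h | ⟨i', hi', j', hj', h, hs⟩)
      · omega
      · rw [hc] at hj' h
        have : j = j' := by
          have h3 : n * i + j = n * i' + j' := by omega
          have := congrArg (· % n) h3
          simpa [Nat.mul_add_mod, Nat.mod_eq_of_lt hj, Nat.mod_eq_of_lt hj'] using this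
        rwa [this]
    · exact fun h => Or.inr ⟨i, hr ▸ hi, j, hc ▸ hj, by rw [hc], h⟩
  rw [encodeMatrix, listOutput, hd, List.range_add, List.filter_append, List.map_append,
    List.range_add, List.filter_append, List.map_append]
  have h3 : ((List.map (fun t => 2 + m * n + t) (List.range d)).filter
      fun t => decide (SelectedPosition x t)) = [] := by
    rw [List.filter_eq_nil_iff]
    intro t ht
    obtain ⟨t, -, rfl⟩ := List.mem_map.1 ht
    simpa using h1 t
  have h4 : ((List.range 2).filter fun t => decide (SelectedPosition x t)).map (selectedValue x) =
      [m, (selectedColumns x n).card] := by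
    have : List.range 2 = [0, 1] := rfl
    have e0 : SelectedPosition x 0 := Or.inl (by omega)
    have e1 : SelectedPosition x 1 := Or.inl (by omega)
    have e2 : selectedValue x 1 = (selectedColumns x n).card := by
      rw [selectedValue, if_pos rfl, hc, card_range_filter, selectedColumns,
        Set.ncard_eq_toFinset_card', Set.toFinset_ofPred]
    have e3 : selectedValue x 0 = m := by rw [← hr]; rfl
    simp [this, e0, e1, e2, e3]
  rw [h3, h4, List.map_nil, List.append_nil, List.filter_map, List.map_map, range_mul_filter_map]
  congr 1
  simp only [List.cons_append, List.nil_append]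
  congr 2
  rw [← List.map_coe_finRange_eq_range (n := m), List.flatMap_map]
  congr 1
  funext i
  rw [← List.map_coe_finRange_eq_range, List.filter_map, List.map_map]
  have h5 : (List.finRange n).filter ((fun j => ((fun t => decide (SelectedPosition x t)) ∘
      fun t => 2 + t) (n * (i : ℕ) + j)) ∘ fun j : Fin n => (j : ℕ)) =
      (List.finRange n).filter fun j => decide (j ∈ selectedColumns x n) := by
    refine List.filter_congr fun j _ => ?_
    simp only [Function.comp, selectedColumns, Finset.mem_filter, Finset.mem_univ, true_and]
    exact decide_eq_decide.2 (h2 i i.2 j j.2)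
  rw [h5, ← map_orderEmbOfFin, List.map_map]
  refine List.map_congr_left fun k _ => ?_
  simp only [Function.comp, Matrix.submatrix_apply, id]
  have := entry_encodeMatrix e M Z i ((selectedColumns x n).orderEmbOfFin rfl k)
  rw [entry, ← hx, hc] at this
  rw [← this, selectedValue, if_neg (by omega)]

end

/-! ### Witnesses and reductions -/

/-- The mask, the tables of `L` and `C`, and the three-dimensional table of partial sums are stored
one after the other in base `b`; division with remainder recovers the indices. -/
theorem exists_tables (b B : ℕ) (mask : ℕ → ℕ) (L C : ℕ → ℕ → ℕ) (P : ℕ → ℕ → ℕ → ℕ)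
    (hm : ∀ j, mask j ≤ B) (hL : ∀ i j, L i j ≤ B) (hC : ∀ i j, C i j ≤ B)
    (hP : ∀ i j a, P i j a ≤ B) :
    ∃ y : List Bool, y.length ≤ (b + 2 * (b * b) + b * (b * b)) * (B + 1) ∧
      (∀ j < b, num y j = mask j) ∧
      (∀ i < b, ∀ j < b, num y (b + (b * i + j)) = L i j) ∧
      (∀ i < b, ∀ j < b, num y (b + b * b + (b * i + j)) = C i j) ∧
      ∀ i < b, ∀ j < b, ∀ a < b, num y (b + 2 * (b * b) + (b * (b * i + j) + a)) = P i j a := by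
  let f : ℕ → ℕ := fun t =>
    if t < b then mask t
    else if t < b + b * b then L ((t - b) / b) ((t - b) % b)
    else if t < b + 2 * (b * b) then C ((t - (b + b * b)) / b) ((t - (b + b * b)) % b)
    else P ((t - (b + 2 * (b * b))) / b / b) ((t - (b + 2 * (b * b))) / b % b)
      ((t - (b + 2 * (b * b))) % b)
  have hf : ∀ t, f t ≤ B := by
    intro t
    simp only [f]
    split_ifs
    exacts [hm _, hL _ _, hC _ _, hP _ _ _]
  set K := b + 2 * (b * b) + b * (b * b) with hK
  have hnum : ∀ t < K, num (encodeNats ((List.range K).map f)) t = f t := by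
    intro t ht
    have := num_encodeNats ((List.range K).map f) [] (j := t) (by simpa using ht)
    rw [List.append_nil] at this
    rw [this]; simp
  have hdm : ∀ i j, j < b → (b * i + j) / b = i ∧ (b * i + j) % b = j := by
    intro i j hj
    exact ⟨by rw [Nat.mul_add_div (by omega), Nat.div_eq_of_lt hj, add_zero],
      by rw [Nat.mul_add_mod, Nat.mod_eq_of_lt hj]⟩
  have hlt : ∀ c i j, i < c → j < b → b * i + j < b * c := by
    intro c i j hi hj
    have := Nat.mul_le_mul_left b hi
    rw [Nat.mul_succ] at this
    omega
  refine ⟨encodeNats ((List.range K).map f), ?_, fun j hj => ?_, fun i hi j hj => ?_,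
    fun i hi j hj => ?_, fun i hi j hj a ha => ?_⟩
  · refine (length_encodeNats_le (B := B) ?_).trans (by simp)
    intro k hk
    obtain ⟨t, -, rfl⟩ := List.mem_map.1 hk
    exact hf t
  · rw [hnum _ (by omega)]
    simp only [f, if_pos hj]
  · have := hlt b i j hi hj
    rw [hnum _ (by omega)]
    simp only [f]
    rw [if_neg (by omega), if_pos (by omega), Nat.add_sub_cancel_left, (hdm i j hj).1,
      (hdm i j hj).2]
  · have := hlt b i j hi hj
    rw [hnum _ (by omega)]
    simp only [f]
    rw [if_neg (by omega), if_neg (by omega), if_pos (by omega), Nat.add_sub_cancel_left,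
      (hdm i j hj).1, (hdm i j hj).2]
  · have h1 := hlt b i j hi hj
    have h2 := hlt (b * b) (b * i + j) a h1 ha
    rw [hnum _ (by omega)]
    simp only [f]
    rw [if_neg (by omega), if_neg (by omega), if_neg (by omega), Nat.add_sub_cancel_left,
      (hdm _ a ha).1, (hdm _ a ha).2, (hdm i j hj).1, (hdm i j hj).2]

section

variable {F : Type*} [Field F] {q : ℕ} {e : F ≃ Fin q} {m n : ℕ} {M : Matrix (Fin m) (Fin n) F}
  {Z x : List Bool} {r : ℕ} {J : Finset (Fin n)}

theorem columnReduction_of_witness (hx : x = encodeMatrix e M ++ Z)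
    (hJ : ∀ j : Fin n, j ∈ J ↔ Active x (nextChanges x) (nextRound x) j) {y : List Bool}
    (hy : Witness e x y r) :
    ∃ J', ColumnReduction M (nextChanges x) r J J' ∧
      (∀ j : Fin n, (j : ℕ) < answerCount x % codeLength x →
        (j ∈ J' ↔ ¬ Answer x (codeLength x * nextBlock x + j))) ∧
      ∀ j : Fin n, (j : ℕ) = answerCount x % codeLength x → j ∉ J' := by
  classical
  have hr : rowCount x = m := hx ▸ rowCount_encodeMatrix e M Z
  have hc : colCount x = n := hx ▸ colCount_encodeMatrix e M Z
  have hent : ∀ (i : Fin m) (j : Fin n), entry x i j = e (M i j) := fun i j =>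
    hx ▸ entry_encodeMatrix e M Z i j
  obtain ⟨h1, h2, h3, h4, h5, h6⟩ := hy
  rw [hc] at h1 h2 h3 h5 h6
  rw [hr] at h5 h6
  set b := codeLength x
  refine ⟨Finset.univ.filter fun j : Fin n => num y j ≠ 0, ⟨?_, ?_,
    .of fun i j => decodeElement e (num y (b + (b * i + j))),
    .of fun a j => decodeElement e (num y (b + b * b + (b * a + j))), fun i => ?_,
    fun i j hj => ?_⟩, fun j hj => ?_, fun j hj => ?_⟩
  · intro j hj
    exact (hJ j).2 (h1 j j.2 (by simpa using hj))
  · rw [card_range_filter, Set.ncard_eq_toFinset_card', Set.toFinset_ofPred] at h2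
    exact h2
  · have := h5 i i.2
    rw [card_range_filter] at this
    refine le_trans (le_of_eq ?_) this
    congr 1
    ext j
    simp only [hJ, Set.mem_ofPred_eq, hent, decodeElement_val, Matrix.of_apply, ne_eq]
  · obtain ⟨h7, h8, h9⟩ := h6 i i.2 j j.2 ((hJ j).1 hj)
    -- The local checks force the third table to consist of the partial sums, by induction on the
    -- number of terms.
    have key : ∀ a ≤ n, decodeElement e (num y (b + 2 * (b * b) + (b * (b * i + j) + a))) =
        ∑ a' ∈ Finset.range a, if num y a' ≠ 0 then
          decodeElement e (num y (b + (b * i + a'))) *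
            decodeElement e (num y (b + b * b + (b * a' + j))) else 0 := by
      intro a
      induction a with
      -- The number `q` lies outside the enumeration and therefore decodes to 0, whatever number `e`
      -- gives to 0.
      | zero => intro _; rw [h7]; simp [decodeElement]
      | succ a ih =>
        intro ha
        rw [Finset.sum_range_succ, ← ih (by omega)]
        by_cases h0 : num y a = 0
        · rw [(h9 a (by omega)).1 h0]; simp [h0]
        · rw [(h9 a (by omega)).2 h0, if_pos h0]
    rw [Matrix.of_apply, ← h8, key n le_rfl, Finset.sum_range, Finset.sum_filter]
    rfl
  · simpa using h3 j hj j.2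
  · simp [hj, h4]

theorem exists_witness (hx : x = encodeMatrix e M ++ Z)
    (hJ : ∀ j : Fin n, j ∈ J ↔ Active x (nextChanges x) (nextRound x) j) {J' : Finset (Fin n)}
    (hJ' : ColumnReduction M (nextChanges x) r J J')
    (h3 : ∀ j : Fin n, (j : ℕ) < answerCount x % codeLength x →
        (j ∈ J' ↔ ¬ Answer x (codeLength x * nextBlock x + j)))
    (h4 : ∀ j : Fin n, (j : ℕ) = answerCount x % codeLength x → j ∉ J') :
    ∃ y : List Bool, y.length ≤ (x.length + 2 * (x.length * x.length) +
      x.length * (x.length * x.length)) * (q + 1) ∧ Witness e x y r := by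
  classical
  have hr : rowCount x = m := hx ▸ rowCount_encodeMatrix e M Z
  have hc : colCount x = n := hx ▸ colCount_encodeMatrix e M Z
  have hent : ∀ (i : Fin m) (j : Fin n), entry x i j = e (M i j) := fun i j =>
    hx ▸ entry_encodeMatrix e M Z i j
  have hcl : codeLength x = (encodeMatrix e M).length := hx ▸ codeLength_encodeMatrix e M Z
  have hbig := le_length_encodeMatrix e M
  have hbx := codeLength_le x
  rw [← hcl] at hbig
  obtain ⟨hsub, hcard, L, C, hL, hC⟩ := hJ'
  set b := codeLength x with hb
  -- Needed for the mask values 0 and 1 to respect the common bound `q` on table entries.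
  have hq : 1 ≤ q := Nat.one_le_iff_ne_zero.2 fun h => by subst h; exact (e 0).elim0
  let term : Fin m → Fin n → ℕ → F := fun i j a =>
    if h : a < n then if (⟨a, h⟩ : Fin n) ∈ J' then L i ⟨a, h⟩ * C ⟨a, h⟩ j else 0 else 0
  obtain ⟨y, hy, y1, y2, y3, y4⟩ := exists_tables b q
    (fun j => if ∃ h : j < n, (⟨j, h⟩ : Fin n) ∈ J' then 1 else 0)
    (fun i j => if h : i < m ∧ j < n then e (L ⟨i, h.1⟩ ⟨j, h.2⟩) else 0)
    (fun i j => if h : i < n ∧ j < n then e (C ⟨i, h.1⟩ ⟨j, h.2⟩) else 0)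
    (fun i j a => if h : i < m ∧ j < n then
      e (∑ a' ∈ Finset.range a, term ⟨i, h.1⟩ ⟨j, h.2⟩ a') else 0)
    (fun j => by split_ifs <;> omega)
    (fun i j => by split_ifs; exacts [(Fin.is_lt _).le, Nat.zero_le _])
    (fun i j => by split_ifs; exacts [(Fin.is_lt _).le, Nat.zero_le _])
    (fun i j a => by split_ifs; exacts [(Fin.is_lt _).le, Nat.zero_le _])
  have z1 : ∀ j : Fin n, num y j ≠ 0 ↔ j ∈ J' := by
    intro j
    rw [y1 j (by omega)]
    simp
  have z2 : ∀ (i : Fin m) (j : Fin n), decodeElement e (num y (b + (b * i + j))) = L i j := by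
    intro i j
    rw [y2 i (by omega) j (by omega), dif_pos ⟨i.2, j.2⟩, decodeElement_val]
  have z3 : ∀ a j : Fin n, decodeElement e (num y (b + b * b + (b * a + j))) = C a j := by
    intro a j
    rw [y3 a (by omega) j (by omega), dif_pos ⟨a.2, j.2⟩, decodeElement_val]
  have z4 : ∀ (i : Fin m) (j : Fin n), ∀ a ≤ n,
      decodeElement e (num y (b + 2 * (b * b) + (b * (b * i + j) + a))) =
        ∑ a' ∈ Finset.range a, term i j a' := by
    intro i j a ha
    rw [y4 i (by omega) j (by omega) a (by omega), dif_pos ⟨i.2, j.2⟩, decodeElement_val]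
  refine ⟨y, hy.trans (by gcongr), ?_⟩
  rw [Witness, ← hb, hc, hr]
  refine ⟨fun j hj h => ?_, ?_, fun j hj hj' => ?_, ?_, fun i hi => ?_, fun i hi j hj hA => ?_⟩
  · exact (hJ ⟨j, hj⟩).1 (hsub ((z1 ⟨j, hj⟩).1 h))
  · rw [card_range_filter, Set.ncard_eq_toFinset_card', Set.toFinset_ofPred]
    refine le_trans (le_of_eq ?_) hcard
    congr 1
    ext j
    simp [z1]
  · rw [z1 ⟨j, hj'⟩]
    exact h3 ⟨j, hj'⟩ hj
  -- A block has `b > n` answers, so the column asked about may not exist; its mask entry is 0 then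
  -- as well.
  · rw [y1 _ (Nat.mod_lt _ (by omega)), if_neg]
    rintro ⟨h, h'⟩
    exact h4 ⟨_, h⟩ rfl h'
  · rw [card_range_filter]
    refine le_trans (le_of_eq ?_) (hL ⟨i, hi⟩)
    congr 1
    ext j
    have e1 := z2 ⟨i, hi⟩ j
    have e2 := hent ⟨i, hi⟩ j
    simp only at e1 e2
    simp only [hJ, Set.mem_ofPred_eq, e1, e2, decodeElement_val, ne_eq]
  · have w2 := z2 ⟨i, hi⟩
    have w4 := z4 ⟨i, hi⟩ ⟨j, hj⟩
    simp only at w2 w4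
    refine ⟨?_, ?_, fun a ha => ⟨fun h0 => ?_, fun h0 => ?_⟩⟩
    · rw [w4 0 (by omega)]; simp [decodeElement]
    · have := w2 ⟨j, hj⟩
      simp only at this
      rw [w4 n le_rfl, this, hC ⟨i, hi⟩ ⟨j, hj⟩ ((hJ ⟨j, hj⟩).2 hA), Finset.sum_range]
      simp [term]
    · have : ¬ (⟨a, ha⟩ : Fin n) ∈ J' := by rw [← z1]; simpa using h0
      rw [w4 _ (by omega), w4 _ (by omega), Finset.sum_range_succ]
      simp [term, ha, this]
    · have h1 : (⟨a, ha⟩ : Fin n) ∈ J' := (z1 ⟨a, ha⟩).1 h0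
      have h2 := w2 ⟨a, ha⟩
      have h3 := z3 ⟨a, ha⟩ ⟨j, hj⟩
      simp only at h2 h3
      rw [w4 _ (by omega), w4 _ (by omega), Finset.sum_range_succ, h2, h3]
      simp [term, ha, h1]

end

/-! ### The greedy search -/

/-- If some solution exists, then for every `c` one exists that agrees with the answers below `c`. A
positive answer supplies a solution without column `c`; after a negative one, every solution
agreeing so far contains `c`. If no solution exists, all answers are negative and nothing is
removed. -/
theorem greedy_spec {n : ℕ} {P : Finset (Fin n) → Prop} {B : ℕ → Prop}
    (hB : ∀ c < n, B c ↔ ∃ J', P J' ∧ (∀ j : Fin n, (j : ℕ) < c → (j ∈ J' ↔ ¬ B j)) ∧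
      ∀ j : Fin n, (j : ℕ) = c → j ∉ J') :
    ((¬ ∃ J', P J') ∧ ∀ c < n, ¬ B c) ∨ ∃ J', P J' ∧ ∀ j : Fin n, j ∈ J' ↔ ¬ B j := by
  by_cases h : ∃ J', P J'
  · right
    have key : ∀ c ≤ n, ∃ J', P J' ∧ ∀ j : Fin n, (j : ℕ) < c → (j ∈ J' ↔ ¬ B j) := by
      intro c
      induction c with
      | zero => exact fun _ => let ⟨J', hJ'⟩ := h; ⟨J', hJ', fun j hj => absurd hj (by omega)⟩
      | succ c ih =>
        intro hc
        by_cases hBc : B c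
        · obtain ⟨J', h1, h2, h3⟩ := (hB c hc).1 hBc
          refine ⟨J', h1, fun j hj => ?_⟩
          rcases Nat.lt_succ_iff_lt_or_eq.1 hj with hj | hj
          · exact h2 j hj
          · exact iff_of_false (h3 j hj) (by rw [hj]; exact not_not.2 hBc)
        · obtain ⟨J', h1, h2⟩ := ih (by omega)
          refine ⟨J', h1, fun j hj => ?_⟩
          rcases Nat.lt_succ_iff_lt_or_eq.1 hj with hj | hj
          · exact h2 j hj
          · refine iff_of_true ?_ (by rwa [hj])
            -- Otherwise `J'` itself would justify a positive answer.
            by_contra hj'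
            refine hBc ((hB c hc).2 ⟨J', h1, h2, fun j' hj'' => ?_⟩)
            rwa [Fin.ext (hj''.trans hj.symm)]
    obtain ⟨J', h1, h2⟩ := key n le_rfl
    exact ⟨J', h1, fun j => h2 j j.2⟩
  · refine Or.inl ⟨h, fun c hc hBc => ?_⟩
    obtain ⟨J', h1, -⟩ := (hB c hc).1 hBc
    exact h ⟨J', h1⟩

open Classical in
/-- The columns present after `k` reductions, when the answers are given by `B`. -/
noncomputable def remaining (B : ℕ → Prop) (b n s k : ℕ) : Finset (Fin n) :=
  Finset.univ.filter fun j => ∀ k' < k, ¬ B (b * (b * s + k') + j)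

section

variable {F : Type*} [Field F] {m n : ℕ} {M : Matrix (Fin m) (Fin n) F} {ε : ℝ} {B : ℕ → Prop}
  {b s : ℕ}

theorem mem_remaining_succ {k : ℕ} {j : Fin n} : j ∈ remaining B b n s (k + 1) ↔
    j ∈ remaining B b n s k ∧ ¬ B (b * (b * s + k) + j) := by
  simp only [remaining, Finset.mem_filter, Finset.mem_univ, true_and, Nat.lt_succ_iff_lt_or_eq]
  constructor
  · exact fun h => ⟨fun k' hk' => h k' (Or.inl hk'), h k (Or.inr rfl)⟩
  · rintro ⟨h1, h2⟩ k' (hk' | rfl)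
    exacts [h1 k' hk', h2]

/-- The answers `B` are those about reductions of the columns that are present. -/
def CorrectAnswers (M : Matrix (Fin m) (Fin n) F) (ε : ℝ) (b : ℕ) (B : ℕ → Prop) : Prop :=
  ∀ s, ∀ k < b, ∀ c < b, B (b * (b * s + k) + c) ↔
    ∃ J', ColumnReduction M s ⌊ε * (remaining B b n s k).card⌋₊ (remaining B b n s k) J' ∧
      (∀ j : Fin n, (j : ℕ) < c → (j ∈ J' ↔ ¬ B (b * (b * s + k) + j))) ∧
      ∀ j : Fin n, (j : ℕ) = c → j ∉ J'

theorem CorrectAnswers.remaining_succ (hB : CorrectAnswers M ε b B) (hn : n < b) {k : ℕ}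
    (hk : k < b) :
    ((¬ ∃ J', ColumnReduction M s ⌊ε * (remaining B b n s k).card⌋₊ (remaining B b n s k) J') ∧
      remaining B b n s (k + 1) = remaining B b n s k) ∨
    ColumnReduction M s ⌊ε * (remaining B b n s k).card⌋₊ (remaining B b n s k)
      (remaining B b n s (k + 1)) := by
  rcases greedy_spec (n := n) (B := fun c => B (b * (b * s + k) + c))
    (fun c hc => hB s k hk c (hc.trans hn)) with ⟨h1, h2⟩ | ⟨J', h1, h2⟩
  · refine Or.inl ⟨h1, ?_⟩
    ext j
    rw [mem_remaining_succ]
    exact and_iff_left (h2 j j.2)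
  · right
    have : remaining B b n s (k + 1) = J' := by
      ext j
      rw [mem_remaining_succ, ← h2]
      exact and_iff_right_of_imp fun h => h1.1 h
    rwa [this]

theorem CorrectAnswers.chain (hB : CorrectAnswers M ε b B) (hn : n < b) {k : ℕ} (hk : k ≤ b) :
    Relation.ReflTransGen (fun I I' => ColumnReduction M s ⌊ε * I.card⌋₊ I I') Finset.univ
      (remaining B b n s k) := by
  induction k with
  | zero =>
    have : remaining B b n s 0 = Finset.univ := by ext; simp [remaining]
    rw [this]
  | succ k ih =>
    rcases hB.remaining_succ (s := s) hn hk with ⟨-, h⟩ | h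
    · rw [h]; exact ih (by omega)
    · exact (ih (by omega)).tail h

/-- Every successful round removes a column from a non-empty set, and a failed round leaves the set
unchanged and irreducible. Since `b > n`, the `b` rounds suffice to get stuck or to run empty, and
the latter is excluded by `hs`. -/
theorem CorrectAnswers.stuck (hB : CorrectAnswers M ε b B) (hε₀ : 0 < ε) (hε₁ : ε < 1)
    (hn : n < b) (hs : 0 < (remaining B b n s b).card) :
    ¬ ∃ J', ColumnReduction M s ⌊ε * (remaining B b n s b).card⌋₊ (remaining B b n s b) J' := by
  have key : ∀ k ≤ b, (¬ ∃ J', ColumnReduction M s ⌊ε * (remaining B b n s k).card⌋₊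
      (remaining B b n s k) J') ∨ (remaining B b n s k).card + k ≤ n ∨
      (remaining B b n s k).card = 0 := by
    intro k
    induction k with
    | zero => exact fun _ => Or.inr (Or.inl (by
        simpa using Finset.card_le_univ (remaining B b n s 0)))
    | succ k ih =>
      intro hk
      rcases hB.remaining_succ (s := s) hn hk with ⟨h1, h2⟩ | h
      · rw [h2]; exact Or.inl h1
      · right
        have hsub := Finset.card_le_card h.1
        rcases ih (by omega) with h' | h' | h'
        · exact absurd ⟨_, h⟩ h'
        · rcases Nat.eq_zero_or_pos (remaining B b n s k).card with h0 | h0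
          · right; omega
          · left
            have := card_lt_of_columnReduction hε₀ hε₁ h0 h
            omega
        · right; omega
  rcases key b le_rfl with h | h | h
  · exact h
  · omega
  · omega

/-- The best of the final sets of columns is rigid. -/
theorem CorrectAnswers.rigid (hB : CorrectAnswers M ε b B) (hε₀ : 0 < ε) (hε₁ : ε < 1)
    (hn : n < b) {τ t : ℝ} (hs : (s : ℝ) < τ) (hτ : τ ≤ s + 1) (ht : (s : ℝ) ≤ t)
    (ht' : s * (2 + Real.logb 2 (n / τ) / Real.logb 2 (1 / ε)) ≤ t)
    (hM : ¬ HasLinearDataStructure M (n / (1 - ε)) t) {J : Finset (Fin n)}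
    (hJ : ∀ j, j ∈ J ↔ ∃ s < b, (s < (remaining B b n s b).card ∧ ∀ s' < b, s < s' →
      ¬ s' < (remaining B b n s' b).card) ∧ j ∈ remaining B b n s b) :
    τ ≤ J.card ∧ τ ≤ rowRigidity (M.submatrix id (J.orderEmbOfFin rfl)) (ε * J.card) := by
  classical
  -- For the `s` belonging to `τ`, a small final set would give the forbidden data structure.
  have hsJ : s < (remaining B b n s b).card := by
    by_contra h
    exact hM (hasLinearDataStructure_of_chain M hε₀ hε₁ hs hτ ht ht' (not_lt.1 h)
      (hB.chain hn le_rfl))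
  have hcard : ∀ s, (remaining B b n s b).card ≤ n := fun s => by
    simpa using Finset.card_le_univ (remaining B b n s b)
  let S := (Finset.range b).filter fun s => s < (remaining B b n s b).card
  have hsS : s ∈ S := by
    simp only [S, Finset.mem_filter, Finset.mem_range]
    exact ⟨by have := hcard s; omega, hsJ⟩
  obtain ⟨s', hs'S, hmax⟩ := S.exists_max_image id ⟨s, hsS⟩
  have hss' : s ≤ s' := hmax s hsS
  simp only [S, Finset.mem_filter, Finset.mem_range] at hs'S
  have hJ' : J = remaining B b n s' b := by
    ext j
    rw [hJ]
    constructor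
    · rintro ⟨s₂, h1, ⟨h2, h3⟩, h4⟩
      have h5 : s₂ ≤ s' := hmax s₂ (by simp [S, h1, h2])
      rcases h5.lt_or_eq with h | rfl
      · exact absurd hs'S.2 (h3 s' hs'S.1 h)
      · exact h4
    · refine fun h => ⟨s', hs'S.1, ⟨hs'S.2, fun s₂ h1 h2 h3 => ?_⟩, h⟩
      have : s₂ ≤ s' := hmax s₂ (by simp [S, h1, h3])
      omega
  subst hJ'
  -- Both the number of columns and the rigidity exceed the maximal `s'`, and `s' ≥ s` brings them
  -- to at least `τ`.
  have hcast : τ ≤ ((s' + 1 : ℕ) : ℝ) := hτ.trans (by exact_mod_cast Nat.succ_le_succ hss')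
  refine ⟨hcast.trans (Nat.cast_le.2 hs'S.2), hcast.trans (Nat.cast_le.2 ?_)⟩
  exact lt_rowRigidity_of_not_columnReduction M hε₀.le s' _
    (hB.stuck hε₀ hε₁ hn (by omega))

end

/-! ### The answers of the oracle -/

/-- Answers are never overwritten: answer `t` stays at offset `t` behind the starting word, where
all later queries can read it. -/
theorem iterate_answerStep (O : Set (List Bool)) (i : ℕ) (w : List Bool) :
    (answerStep O)^[i] w = w ++ (List.range i).map fun t =>
      open Classical in decide ((answerStep O)^[t] w ∈ O) := by
  induction i with
  | zero => simp
  | succ i ih =>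
    rw [Function.iterate_succ_apply', answerStep, List.range_succ, List.map_append,
      ← List.append_assoc, ← ih]
    rfl

/-- The language of the words after which a witness exists. -/
def reductionLanguage {F : Type*} [Field F] {q : ℕ} (e : F ≃ Fin q) (ε : ℝ) : Set (List Bool) :=
  {x | ∃ y : List Bool, y.length ≤ (x.length + 2 * (x.length * x.length) +
    x.length * (x.length * x.length)) * (q + 1) ∧
      Witness e x y ⌊ε * (activeCount x (nextChanges x) (nextRound x) : ℕ)⌋₊}

/-- The computability of `⌊εk⌋` enters here, for the bound on the number of remaining columns that
the verifier checks. -/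
theorem inNP_reductionLanguage {F : Type*} [Field F] {q : ℕ} (e : F ≃ Fin q) {ε : ℝ}
    (hε : PolyTimeUnary ∅ fun n : ℕ => List.replicate ⌊ε * (n : ℝ)⌋₊ true) :
    InNP (reductionLanguage e ε) := by
  classical
  refine ⟨_, (.X + 2 * (.X * .X) + .X * (.X * .X)) * (q + 1), polyTime_verifier hε
    uniform_activeCount (fun x => activeCount_le x _ _) (witness_uniform e), fun x => ?_⟩
  simp only [reductionLanguage, Set.mem_ofPred_eq, decide_eq_true_eq, Polynomial.eval_add,
    Polynomial.eval_mul, Polynomial.eval_X, Polynomial.eval_ofNat, Polynomial.eval_natCast,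
    Polynomial.eval_one]
  rfl

section

variable {F : Type*} {q : ℕ} (e : F ≃ Fin q) {m n : ℕ} (M : Matrix (Fin m) (Fin n) F)

/-- The hypothesis on `i` says that all answers of the first `k` rounds for `s` are already in the
word. -/
theorem active_iterate (O : Set (List Bool)) {i s k : ℕ} (hi : (encodeMatrix e M).length *
    ((encodeMatrix e M).length * s + k) ≤ i) (j : Fin n) :
    Active ((answerStep O)^[i] (encodeMatrix e M)) s k j ↔
      j ∈ remaining (fun t => (answerStep O)^[t] (encodeMatrix e M) ∈ O)
        (encodeMatrix e M).length n s k := by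
  classical
  have hbig := le_length_encodeMatrix e M
  rw [iterate_answerStep, Active, colCount_encodeMatrix, codeLength_encodeMatrix]
  simp only [remaining, Finset.mem_filter, Finset.mem_univ, true_and, j.2, answer_encodeMatrix]
  refine forall₂_congr fun k' hk' => not_congr ?_
  generalize (encodeMatrix e M).length = b at *
  have : b * (b * s + k') + j < i := by
    have h1 : b * (b * s + k' + 1) ≤ b * (b * s + k) := Nat.mul_le_mul_left b (by omega)
    rw [Nat.mul_succ] at h1
    omega
  simp [this]

theorem activeCount_iterate (O : Set (List Bool)) {i s k : ℕ} (hi : (encodeMatrix e M).length *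
    ((encodeMatrix e M).length * s + k) ≤ i) :
    activeCount ((answerStep O)^[i] (encodeMatrix e M)) s k =
      (remaining (fun t => (answerStep O)^[t] (encodeMatrix e M) ∈ O)
        (encodeMatrix e M).length n s k).card := by
  classical
  have h : colCount ((answerStep O)^[i] (encodeMatrix e M)) = n := by
    rw [iterate_answerStep, colCount_encodeMatrix]
  rw [activeCount, card_range_filter, Set.ncard_eq_toFinset_card', Set.toFinset_ofPred, h]
  congr 1
  ext j
  simp [active_iterate e M O hi]

theorem mem_selectedColumns (O : Set (List Bool)) (j : Fin n) :
    let b := (encodeMatrix e M).length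
    let B := fun t => (answerStep O)^[t] (encodeMatrix e M) ∈ O
    j ∈ selectedColumns ((answerStep O)^[b * (b * (b * 1))] (encodeMatrix e M)) n ↔
      ∃ s < b, (s < (remaining B b n s b).card ∧ ∀ s' < b, s < s' →
        ¬ s' < (remaining B b n s' b).card) ∧ j ∈ remaining B b n s b := by
  classical
  intro b B
  set x := (answerStep O)^[b * (b * (b * 1))] (encodeMatrix e M) with hx
  have hcl : codeLength x = b := by rw [hx, iterate_answerStep, codeLength_encodeMatrix]
  have hle : ∀ s < b, b * (b * s + b) ≤ b * (b * (b * 1)) := by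
    intro s hs
    rw [mul_one, ← Nat.mul_succ]
    exact Nat.mul_le_mul_left b (Nat.mul_le_mul_left b hs)
  have h1 : ∀ s < b, (Active x s b j ↔ j ∈ remaining B b n s b) := fun s hs =>
    active_iterate e M O (hle s hs) j
  have h2 : ∀ s < b, activeCount x s b = (remaining B b n s b).card := fun s hs =>
    activeCount_iterate e M O (hle s hs)
  simp only [selectedColumns, Finset.mem_filter, Finset.mem_univ, true_and, Selected, hcl]
  refine exists_congr fun s => and_congr_right fun hs => ?_
  rw [h1 s hs, h2 s hs]
  refine and_congr_left fun _ => and_congr_right fun _ => forall₂_congr fun s' hs' => ?_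
  rw [h2 s' hs']

end

/-- A query with `b * (b * s + k) + c` answers encodes the question about column `c` in round `k`
with `s` changes, recovered by division by `b`. Membership in the language is then existence of a
reduction by `columnReduction_of_witness` and `exists_witness`. -/
theorem correctAnswers {F : Type*} [Field F] {q : ℕ} (e : F ≃ Fin q) {m n : ℕ}
    (M : Matrix (Fin m) (Fin n) F) (ε : ℝ) : CorrectAnswers M ε (encodeMatrix e M).length fun t =>
    (answerStep (reductionLanguage e ε))^[t] (encodeMatrix e M) ∈ reductionLanguage e ε := by
  classical
  intro s k hk c hc
  set O := reductionLanguage e ε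
  set b := (encodeMatrix e M).length with hb
  set x := (answerStep O)^[b * (b * s + k) + c] (encodeMatrix e M) with hx
  have hx' := iterate_answerStep O (b * (b * s + k) + c) (encodeMatrix e M)
  rw [← hx] at hx'
  have hcl : codeLength x = b := by rw [hx', codeLength_encodeMatrix]
  have hac : answerCount x = b * (b * s + k) + c := by rw [hx', answerCount_encodeMatrix]; simp
  have hnb : nextBlock x = b * s + k := by
    rw [nextBlock, hac, hcl, Nat.mul_add_div (by omega), Nat.div_eq_of_lt hc, add_zero]
  have hnc : nextChanges x = s := by
    rw [nextChanges, hnb, hcl, Nat.mul_add_div (by omega), Nat.div_eq_of_lt hk, add_zero]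
  have hnr : nextRound x = k := by
    rw [nextRound, hnb, hcl, Nat.mul_add_mod, Nat.mod_eq_of_lt hk]
  have hcol : answerCount x % codeLength x = c := by
    rw [hac, hcl, Nat.mul_add_mod, Nat.mod_eq_of_lt hc]
  have hact := active_iterate e M O (i := b * (b * s + k) + c) (s := s) (k := k)
    (Nat.le_add_right _ _)
  have hcnt := activeCount_iterate e M O (i := b * (b * s + k) + c) (s := s) (k := k)
    (Nat.le_add_right _ _)
  rw [← hx] at hact hcnt
  have hans : ∀ j < c, (Answer x (codeLength x * nextBlock x + j) ↔
      (answerStep O)^[b * (b * s + k) + j] (encodeMatrix e M) ∈ O) := by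
    intro j hj
    rw [hcl, hnb, hx', answer_encodeMatrix]
    have : b * (b * s + k) + j < b * (b * s + k) + c := by omega
    simp [hj]
  have hJ : ∀ j : Fin n, j ∈ remaining (fun t => (answerStep O)^[t] (encodeMatrix e M) ∈ O) b n s k ↔
      Active x (nextChanges x) (nextRound x) j := by
    intro j
    rw [hnc, hnr]; exact (hact j).symm
  have hmem : x ∈ O ↔ ∃ y : List Bool, y.length ≤ (x.length + 2 * (x.length * x.length) +
      x.length * (x.length * x.length)) * (q + 1) ∧ Witness e x y ⌊ε * ((remaining (fun t =>
        (answerStep O)^[t] (encodeMatrix e M) ∈ O) b n s k).card : ℕ)⌋₊ := by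
    rw [← hcnt]
    change (∃ y : List Bool, _ ∧ Witness e x y _) ↔ _
    rw [hnc, hnr]
  refine hmem.trans ?_
  constructor
  · rintro ⟨y, -, hy⟩
    obtain ⟨J', h1, h2, h3⟩ := columnReduction_of_witness hx' hJ hy
    rw [hnc] at h1
    rw [hcol] at h2 h3
    exact ⟨J', h1, fun j hj => (h2 j hj).trans (not_congr (hans j hj)), h3⟩
  · rintro ⟨J', h1, h2, h3⟩
    refine exists_witness hx' hJ (J' := J') (by rwa [hnc]) (fun j hj => ?_) (by rwa [hcol])
    rw [hcol] at hj
    exact (h2 j hj).trans (not_congr (hans j hj)).symm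

end RigidityDS

/-! ### The main theorem -/

theorem mainTheorem7 (ε δ c : ℝ) (hε₀ : 0 < ε) (hε₁ : ε < 1) (hδ : 0 < δ) :
    ∃ n₀ : ℕ,
      (∀ (F : Type*) [Field F] (m n : ℕ) (M : Matrix (Fin m) (Fin n) F),
        n₀ ≤ n →
        ¬ RigidityDS.HasLinearDataStructure M ((n : ℝ) / (1 - ε)) (δ * Real.logb 2 n ^ c) →
        ∃ (n' : ℕ) (cols : Fin n' ↪o Fin n),
          δ * Real.logb 2 (1 / ε) * Real.logb 2 n ^ (c - 1) ≤ (n' : ℝ) ∧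
          δ * Real.logb 2 (1 / ε) * Real.logb 2 n ^ (c - 1) ≤
            (RigidityDS.rowRigidity (M.submatrix id cols) (ε * n') : ℝ)) ∧
      (RigidityDS.PolyTimeUnary ∅ (fun n : ℕ => List.replicate ⌊ε * (n : ℝ)⌋₊ true) →
        ∀ (F : Type*) [Field F] [Fintype F] (e : F ≃ Fin (Fintype.card F)) (m : ℕ → ℕ)
          (M : ∀ n : ℕ, Matrix (Fin (m n)) (Fin n) F),
        RigidityDS.Explicit e M →
        ∃ (n' : ℕ → ℕ) (cols : ∀ n : ℕ, Fin (n' n) ↪o Fin n),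
          RigidityDS.ComputableInPNP e (fun n => (M n).submatrix id (cols n)) ∧
          ∀ n : ℕ, n₀ ≤ n →
            ¬ RigidityDS.HasLinearDataStructure (M n) ((n : ℝ) / (1 - ε))
                (δ * Real.logb 2 n ^ c) →
            δ * Real.logb 2 (1 / ε) * Real.logb 2 n ^ (c - 1) ≤ (n' n : ℝ) ∧
            δ * Real.logb 2 (1 / ε) * Real.logb 2 n ^ (c - 1) ≤
              (RigidityDS.rowRigidity ((M n).submatrix id (cols n)) (ε * n' n) : ℝ)) := by
  obtain ⟨n₀, h₀⟩ := RigidityDS.exists_threshold ε δ c hε₀ hε₁ hδ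
  refine ⟨n₀, fun F _ m n M hn hM => ?_, fun hε F _ _ e m M hexp => ?_⟩
  · obtain ⟨s, hs, hτ, ht, ht'⟩ := h₀ n hn
    rcases RigidityDS.exists_chain_or_stuck M hε₀ hε₁ s Finset.univ with
      ⟨J, hsJ, hJ⟩ | ⟨Jf, hf, hchain⟩
    · refine ⟨J.card, J.orderEmbOfFin rfl, hτ.trans (by exact_mod_cast hsJ), hτ.trans ?_⟩
      exact_mod_cast RigidityDS.lt_rowRigidity_of_not_columnReduction M hε₀.le s J hJ
    · exact absurd (RigidityDS.hasLinearDataStructure_of_chain M hε₀ hε₁ hs hτ ht ht' hf hchain) hM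
  -- The columns are defined for every `n` from the final word of the search; the threshold `s`
  -- enters only in the proof that they are rigid.
  · let O := RigidityDS.reductionLanguage e ε
    let b : ℕ → ℕ := fun n => (RigidityDS.encodeMatrix e (M n)).length
    let J : ∀ n, Finset (Fin n) := fun n => RigidityDS.selectedColumns
      ((RigidityDS.answerStep O)^[b n * (b n * (b n * 1))] (RigidityDS.encodeMatrix e (M n))) n
    refine ⟨fun n => (J n).card, fun n => (J n).orderEmbOfFin rfl,
      ⟨O, RigidityDS.inNP_reductionLanguage e hε, ?_⟩, fun n hn hM => ?_⟩
    · have h := RigidityDS.polyTime_adaptive O hexp RigidityDS.selectedPosition_uniform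
        RigidityDS.selectedValue_uniform RigidityDS.selectedValue_le
      refine (congrArg (RigidityDS.PolyTimeUnary O) (funext fun n => ?_)).mp h
      exact RigidityDS.listOutput_encodeMatrix e (M n) _ (RigidityDS.iterate_answerStep O _ _)
    · obtain ⟨s, hs, hτ, ht, ht'⟩ := h₀ n hn
      have hbig := RigidityDS.le_length_encodeMatrix e (M n)
      exact (RigidityDS.correctAnswers e (M n) ε).rigid hε₀ hε₁ (by omega) hs hτ ht ht' hM
        (RigidityDS.mem_selectedColumns e (M n) O)
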